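/- **Second overlap identity for Littlewood–Schur functions.** *Notation.* A partition is a non-increasing sequence $\lambda=(\lambda_1,\lambda_2,\dots)$ of non-negative integers that is eventually zero; partitions that differ only by zeros are identified, $\lambda'$ is the conjugate, and the length of $\lambda$ is the number of its positive parts. Write $\lambda_{[r]}=(\lambda_1,\dots,\lambda_r)$ and $\lambda_{(r+1,\dots)}=(\lambda_{r+1},\lambda_{r+2},\dots)$. For sequences $\mathcal X=(x_1,\dots,x_a)$, $\mathcal Y=(y_1,\dots,y_b)$ of elements of a field put $$\Delta(\mathcal X)=\prod_{i<j}(x_i-x_j),\qquad \Delta(\mathcal X;\mathcal Y)=\prod_{i,j}(x_i-y_j),$$ let $-\mathcal X=(-x_1,\dots,-x_a)$, and let $\mathcal X\cup\mathcal Y$ be the concatenation. The Schur function $\mathfrak s_\lambda(\mathcal X)$ in $a$ variables is the polynomial $\det\big(x_i^{\lambda_j+a-j}\big)_{1\le i,j\le a}/\Delta(\mathcal X)$ if $\lambda$ has length at most $a$, and $0$ otherwise. With the Littlewood–Richardson coefficients $c^\lambda_{\mu\nu}$, defined by $\mathfrak s_\mu\mathfrak s_\nu=\sum_\lambda c^\lambda_{\mu\nu}\mathfrak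 s_\lambda$ in any number of variables, the Littlewood–Schur function is $$LS_\lambda(\mathcal X;\mathcal Y)=\sum_{\mu,\nu}c^\lambda_{\mu\nu}\,\mathfrak s_\mu(\mathcal X)\,\mathfrak s_{\nu'}(\mathcal Y).$$ For $m,n\ge 0$, the $(m,n)$-index of $\lambda$ is the largest (possibly negative) integer $k\le\min\{m,n\}$ such that $(m+1-k,\,n+1-k)$ does not lie in the Ferrers diagram $\{(i,j): j\ge 1,\ 1\le i\le\lambda_j\}$. Let $\rho_a=(a-1,\dots,1,0)$. For partitions $\mu,\nu$ of length at most $a$ and $b$, respectively, the $(a,b)$-overlap $\mu\star_{a,b}\nu$ is the partition $\kappa$ of length at most $a+b$, if it exists, such that $\kappa+\rho_{a+b}$ is a rearrangement of the concatenation of $\mu+\rho_a$ (of length $a$) and $\nu+\rho_b$ (of length $b$); $\varepsilon_{a,b}(\mu,\nu)$ is then the sign of the sorting permutation, which is unique because $\kappa+\rho_{a+b}$ is strictly decreasing. *Theorem.* Let $n,m\ge0$ be integers, let $\lambda$ be a partition with $(m,n)$-index $k$, and let $0\le l\le\min\{n-k,n\}$. Let $\mathcal S$, $\mathcal T$ and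 $\mathcal Y$ be sequences of $l$, $n-l$ and $m$ elements of a field $F$, respectively, such that $\Delta(\mathcal Y)\ne0$ and $\Delta(\mathcal S;\mathcal T)\neq0$. Then $$LS_\lambda(-(\mathcal S\cup\mathcal T);\mathcal Y)=\sum_{p=0}^{\min\{l,m\}}\ \sum_{\mathcal U,\mathcal V}\ \sum_{\substack{\mu,\nu:\\ \mu\star_{l-p,\,n-k-l+p}\nu=\lambda_{[n-k]}}}\frac{\Delta(\mathcal V;\mathcal S)\,\Delta(\mathcal T;\mathcal U)}{\Delta(\mathcal V;\mathcal U)\,\Delta(\mathcal T;\mathcal S)}\;\varepsilon_{l-p,\,n-k-l+p}(\mu,\nu)\;LS_{\mu-\langle(m-k)^{l-p}\rangle}(-\mathcal S;\mathcal U)\;LS_{\nu\cup\lambda_{(n+1-k,\dots)}}(-\mathcal T;\mathcal V),$$ where the second sum runs over all ways of splitting $\mathcal Y$ into a subsequence $\mathcal U$ of length $p$ and the complementary subsequence $\mathcal V$ of length $m-p$. Here $\mu-\langle(m-k)^{l-p}\rangle$ is the partition $(\mu_1-(m-k),\dots,\mu_{l-p}-(m-k))$, and $\nu\cup\lambda_{(n+1-k,\dots)}$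 is the partition $(\nu_1,\dots,\nu_{n-k-l+p},\lambda_{n-k+1},\lambda_{n-k+2},\dots)$. -/

import Mathlib

namespace LittlewoodSchur

open MvPolynomial

noncomputable section

/-- `f 0, f 1, …` is a partition (parts indexed from `0`, padded with zeros). Partitions are
represented by Mathlib's Young diagrams, the part `λ_i` being `lam.rowLen (i - 1)`, the length
`lam.colLen 0` and the conjugate `lam.transpose`. -/
def IsPartSeq (f : ℕ → ℕ) : Prop := Antitone f ∧ ∃ N, f N = 0

open Classical in
/-- The partition with parts `f 0, f 1, …`, if this is a partition; otherwise the empty one.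
See `rowLen_ofParts`. -/
def ofParts (f : ℕ → ℕ) : YoungDiagram :=
  if h : IsPartSeq f then
    { cells := (Finset.range (Nat.find h.2) ×ˢ Finset.range (f 0)).filter fun c => c.2 < f c.1
      isLowerSet := by
        unfold IsLowerSet
        rintro ⟨a, b⟩ ⟨c, d⟩ ⟨hca, hdb⟩ hab
        simp only [Finset.coe_filter, Finset.mem_product, Finset.mem_range, Set.mem_ofPred_eq]
          at hca hdb hab ⊢
        have := h.1 hca
        exact ⟨⟨by omega, by omega⟩, by omega⟩ }
  else ⊥

theorem mem_ofParts {f : ℕ → ℕ} (h : IsPartSeq f) (i j : ℕ) : (i, j) ∈ ofParts f ↔ j < f i := by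
  classical
  rw [ofParts, dif_pos h, ← YoungDiagram.mem_cells]
  simp only [Finset.mem_filter, Finset.mem_product, Finset.mem_range, and_iff_right_iff_imp]
  intro hj
  refine ⟨?_, hj.trans_le (h.1 (Nat.zero_le i))⟩
  by_contra hi
  have := h.1 (not_lt.1 hi)
  have := Nat.find_spec h.2
  omega

theorem rowLen_ofParts {f : ℕ → ℕ} (h : IsPartSeq f) (i : ℕ) : (ofParts f).rowLen i = f i := by
  apply le_antisymm
  · by_contra hc
    have := (mem_ofParts h i (f i)).1 (YoungDiagram.mem_iff_lt_rowLen.2 (by omega))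
    omega
  · by_contra hc
    have := YoungDiagram.mem_iff_lt_rowLen.1 ((mem_ofParts h i ((ofParts f).rowLen i)).2 (by omega))
    omega

theorem isPartSeq_rowLen (lam : YoungDiagram) : IsPartSeq lam.rowLen := by
  refine ⟨fun i j h => lam.rowLen_anti i j h, lam.colLen 0, ?_⟩
  by_contra h
  have := YoungDiagram.mem_iff_lt_colLen.1
    (YoungDiagram.mem_iff_lt_rowLen.2 (Nat.pos_of_ne_zero h))
  omega

theorem rowLen_eq_zero_iff (lam : YoungDiagram) (i : ℕ) : lam.rowLen i = 0 ↔ lam.colLen 0 ≤ i := by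
  rw [← not_lt, ← YoungDiagram.mem_iff_lt_colLen, YoungDiagram.mem_iff_lt_rowLen]
  omega

theorem ext_rowLen {lam kap : YoungDiagram} (h : ∀ i, lam.rowLen i = kap.rowLen i) : lam = kap := by
  ext ⟨i, j⟩
  rw [YoungDiagram.mem_cells, YoungDiagram.mem_cells, YoungDiagram.mem_iff_lt_rowLen,
    YoungDiagram.mem_iff_lt_rowLen, h]

/-- `Δ(x) = ∏_{i < j} (x_i - x_j)`. -/
def delta {R : Type*} [CommRing R] {n : ℕ} (x : Fin n → R) : R :=
  ∏ i, ∏ j ∈ Finset.Ioi i, (x i - x j)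

/-- `Δ(x; y) = ∏_{i, j} (x_i - y_j)`. -/
def deltaPair {R : Type*} [CommRing R] {a b : ℕ} (x : Fin a → R) (y : Fin b → R) : R :=
  ∏ i, ∏ j, (x i - y j)

/-- The sequence `lam + ρ_n` of length `n`, where `ρ_n = (n - 1, …, 1, 0)`. -/
def addRho (n : ℕ) (lam : YoungDiagram) : Fin n → ℕ := fun j => lam.rowLen j + (n - 1 - j)

/-- `det (X_i ^ α_j)`. -/
def alternant {n : ℕ} (α : Fin n → ℕ) : MvPolynomial (Fin n) ℤ :=
  Matrix.det (Matrix.of fun i j => X i ^ α j)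

theorem delta_eq_alternant (n : ℕ) :
    delta (X : Fin n → MvPolynomial (Fin n) ℤ) = alternant fun j => n - 1 - (j : ℕ) := by
  have h := Matrix.det_projVandermonde (1 : Fin n → MvPolynomial (Fin n) ℤ) X
  simp only [Pi.one_apply, one_mul] at h
  rw [delta, ← h, alternant]
  congr 1
  ext i j : 2
  rw [Matrix.projVandermonde_apply, Pi.one_apply, one_pow, one_mul, Matrix.of_apply,
    Fin.val_rev, show n - ((j : ℕ) + 1) = n - 1 - j by omega]

theorem X_sub_X_dvd {n : ℕ} (i j : Fin n) (P : MvPolynomial (Fin n) ℤ) :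
    X i - X j ∣ P - aeval (Function.update X i (X j)) P := by
  rw [← Ideal.mem_span_singleton, ← Ideal.Quotient.mk_eq_mk_iff_sub_mem]
  have : (Ideal.Quotient.mkₐ ℤ (Ideal.span {X i - X j})) =
      (Ideal.Quotient.mkₐ ℤ (Ideal.span {X i - X j})).comp
        (aeval (Function.update (X : Fin n → MvPolynomial (Fin n) ℤ) i (X j))) := by
    ext k
    by_cases hk : k = i
    · subst hk
      simp only [Ideal.Quotient.mkₐ_eq_mk, AlgHom.comp_apply, aeval_X, Function.update_self]
      rw [Ideal.Quotient.mk_eq_mk_iff_sub_mem]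
      exact Ideal.mem_span_singleton_self _
    · simp [hk]
  exact DFunLike.congr_fun this P

theorem delta_X_ne_zero (n : ℕ) : delta (X : Fin n → MvPolynomial (Fin n) ℤ) ≠ 0 := by
  refine Finset.prod_ne_zero_iff.2 fun i _ => Finset.prod_ne_zero_iff.2 fun j hj => ?_
  rw [sub_ne_zero]
  exact fun h => (Finset.mem_Ioi.1 hj).ne (X_injective h)

theorem irreducible_X_sub_X {n : ℕ} {i j : Fin n} (h : i ≠ j) :
    Irreducible (X i - X j : MvPolynomial (Fin n) ℤ) := by
  have hc : coeff (Finsupp.single i 1) (X i - X j : MvPolynomial (Fin n) ℤ) = 1 := by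
    rw [coeff_sub, coeff_X, coeff_X, if_pos rfl, if_neg, sub_zero]
    rw [Finsupp.single_left_inj one_ne_zero]; exact h.symm
  apply irreducible_of_totalDegree_eq_one
  · apply ((isHomogeneous_X ℤ i).sub (isHomogeneous_X ℤ j)).totalDegree
    intro h0
    simp [h0] at hc
  · intro x hx
    have := hx (Finsupp.single i 1)
    rw [hc] at this
    exact isUnit_of_dvd_one this

theorem not_X_sub_X_dvd {n : ℕ} {i j k l : Fin n} (hij : i < j) (hkl : k < l)
    (h : ¬(i = k ∧ j = l)) : ¬((X i - X j : MvPolynomial (Fin n) ℤ) ∣ X k - X l) := by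
  rintro ⟨q, hq⟩
  have := congrArg (aeval (Function.update (X : Fin n → MvPolynomial (Fin n) ℤ) i (X j))) hq
  simp only [map_sub, map_mul, aeval_X, Function.update_self,
    Function.update_of_ne hij.ne', sub_self, zero_mul, sub_eq_zero] at this
  by_cases hk : k = i
  · subst hk
    rw [Function.update_self, Function.update_of_ne hkl.ne'] at this
    exact h ⟨rfl, X_injective this⟩
  · rw [Function.update_of_ne hk] at this
    by_cases hl : l = i
    · subst hl
      rw [Function.update_self] at this
      have := X_injective this
      subst this
      exact absurd hij (not_lt.2 hkl.le)
    · rw [Function.update_of_ne hl] at this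
      exact hkl.ne (X_injective this)

theorem delta_dvd_alternant {n : ℕ} (α : Fin n → ℕ) :
    delta (X : Fin n → MvPolynomial (Fin n) ℤ) ∣ alternant α := by
  rw [delta, Finset.prod_sigma' Finset.univ (fun i : Fin n => Finset.Ioi i)
    (fun i j => (X i - X j : MvPolynomial (Fin n) ℤ))]
  apply Finset.prod_dvd_of_isRelPrime
  · rintro ⟨i, j⟩ hij ⟨k, l⟩ hkl hne
    simp only [Finset.coe_sigma, Finset.coe_univ, Set.mem_sigma_iff, Set.mem_univ, true_and,
      Finset.coe_Ioi, Set.mem_Ioi] at hij hkl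
    rw [Function.onFun, (irreducible_X_sub_X hij.ne).isRelPrime_iff_not_dvd]
    apply not_X_sub_X_dvd hij hkl
    rintro ⟨rfl, rfl⟩
    exact hne rfl
  · rintro ⟨i, j⟩ hij
    simp only [Finset.mem_sigma, Finset.mem_univ, true_and, Finset.mem_Ioi] at hij
    have h := X_sub_X_dvd i j (alternant α)
    have h0 : aeval (Function.update (X : Fin n → MvPolynomial (Fin n) ℤ) i (X j))
        (alternant α) = 0 := by
      rw [alternant, AlgHom.map_det]
      apply Matrix.det_zero_of_row_eq hij.ne
      ext k : 1
      simp [Function.update_of_ne hij.ne']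
    rwa [h0, sub_zero] at h

/-- The Schur polynomial in `n` variables: the quotient of `det (X_i ^ (λ_j + n - j))` by `Δ(X)`,
or zero if the length of the partition exceeds `n`. See `delta_mul_schurPoly`. -/
def schurPoly (n : ℕ) (lam : YoungDiagram) : MvPolynomial (Fin n) ℤ :=
  if lam.colLen 0 ≤ n then (delta_dvd_alternant (addRho n lam)).choose else 0

theorem schurPoly_of_lt {n : ℕ} {lam : YoungDiagram} (h : n < lam.colLen 0) :
    schurPoly n lam = 0 := if_neg (not_le.2 h)

theorem delta_mul_schurPoly {n : ℕ} {lam : YoungDiagram} (h : lam.colLen 0 ≤ n) :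
    delta X * schurPoly n lam = alternant (addRho n lam) := by
  rw [schurPoly, if_pos h]
  exact (delta_dvd_alternant (addRho n lam)).choose_spec.symm


/-- A sequence of exponents as the exponent of a monomial. -/
def toExp {n : ℕ} (α : Fin n → ℕ) : Fin n →₀ ℕ := Finsupp.equivFunOnFinite.symm α

theorem toExp_apply {n : ℕ} (α : Fin n → ℕ) (i : Fin n) : toExp α i = α i := rfl

theorem monomial_toExp {n : ℕ} (α : Fin n → ℕ) (a : ℤ) :
    monomial (toExp α) a = C a * ∏ i, X i ^ α i := by
  rw [monomial_eq, Finsupp.prod_fintype _ _ (by simp)]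
  rfl

theorem alternant_eq_sum {n : ℕ} (α : Fin n → ℕ) :
    alternant α = ∑ σ : Equiv.Perm (Fin n),
      monomial (toExp (α ∘ σ.symm)) ((Equiv.Perm.sign σ : ℤˣ) : ℤ) := by
  rw [alternant, Matrix.det_apply']
  refine Finset.sum_congr rfl fun σ _ => ?_
  rw [monomial_toExp]
  congr 1
  exact Fintype.prod_equiv σ _ _ fun i => by simp

theorem coeff_alternant {n : ℕ} {α β : Fin n → ℕ} (hα : StrictAnti α) (hβ : StrictAnti β) :
    coeff (toExp β) (alternant α) = if α = β then 1 else 0 := by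
  classical
  have key : ∀ σ : Equiv.Perm (Fin n), α ∘ σ.symm = β → α = β ∧ σ = 1 := by
    intro σ h
    have h1 : (OrderDual.toDual ∘ α : Fin n → ℕᵒᵈ) = OrderDual.toDual ∘ β := by
      have h2 : StrictMono (OrderDual.toDual ∘ α : Fin n → ℕᵒᵈ) := fun i j hij => hα hij
      have h3 : StrictMono (OrderDual.toDual ∘ β : Fin n → ℕᵒᵈ) := fun i j hij => hβ hij
      rw [← h2.range_inj h3, ← h, ← Function.comp_assoc, EquivLike.range_comp]
    have h2 : α = β := funext fun i => congrFun h1 i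
    refine ⟨h2, ?_⟩
    rw [← h2] at h
    ext i
    have := hα.injective (congrFun h (σ i))
    simp at this
    simp [← this]
  rw [alternant_eq_sum, coeff_sum]
  split_ifs with h
  · subst h
    rw [Finset.sum_eq_single 1]
    · rw [coeff_monomial, if_pos]
      · simp
      · rfl
    · intro σ _ hσ
      rw [coeff_monomial, if_neg]
      exact fun he => hσ (key σ (Finsupp.equivFunOnFinite.symm.injective he)).2
    · simp
  · refine Finset.sum_eq_zero fun σ _ => ?_
    rw [coeff_monomial, if_neg]
    exact fun he => h (key σ (Finsupp.equivFunOnFinite.symm.injective he)).1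

/-- Permuting the variables multiplies `P` by the sign of the permutation. -/
def IsAlternating {n : ℕ} (P : MvPolynomial (Fin n) ℤ) : Prop :=
  ∀ σ : Equiv.Perm (Fin n), rename σ P = C ((Equiv.Perm.sign σ : ℤˣ) : ℤ) * P

theorem isAlternating_alternant {n : ℕ} (α : Fin n → ℕ) : IsAlternating (alternant α) := by
  intro σ
  have := Matrix.det_permute σ (Matrix.of fun i j => (X i : MvPolynomial (Fin n) ℤ) ^ α j)
  rw [alternant, AlgHom.map_det]
  convert this using 2
  · ext i j : 2
    simp
  · simp

theorem IsAlternating.eq_zero {n : ℕ} {P : MvPolynomial (Fin n) ℤ} (hP : IsAlternating P)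
    (h : ∀ β, StrictAnti β → coeff (toExp β) P = 0) : P = 0 := by
  have hc : ∀ (σ : Equiv.Perm (Fin n)) (β : Fin n → ℕ),
      coeff (toExp β) P = ((Equiv.Perm.sign σ : ℤˣ) : ℤ) * coeff (toExp (β ∘ σ.symm)) P := by
    intro σ β
    have h1 := coeff_rename_mapDomain σ σ.injective P (toExp β)
    rw [hP σ, coeff_C_mul] at h1
    rw [← h1]
    congr 2
    ext i
    rw [← Finsupp.equivMapDomain_eq_mapDomain, Finsupp.equivMapDomain_apply]
    rfl
  ext d
  obtain ⟨β, rfl⟩ : ∃ β, toExp β = d := ⟨d, by ext; rfl⟩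
  rw [coeff_zero]
  by_cases hβ : Function.Injective β
  · let f : Fin n → ℕᵒᵈ := fun i => OrderDual.toDual (β i)
    have hf : Function.Injective f := fun i j hij => hβ hij
    have hm : StrictMono (f ∘ Tuple.sort f) :=
      (Tuple.monotone_sort f).strictMono_of_injective (hf.comp (Tuple.sort f).injective)
    rw [hc (Tuple.sort f).symm β, h, mul_zero]
    exact fun i j hij => hm hij
  · simp only [Function.Injective, not_forall] at hβ
    obtain ⟨i, j, hij, hne⟩ := hβ
    have h1 := hc (Equiv.swap i j) β
    have h2 : β ∘ (Equiv.swap i j).symm = β := by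
      ext k
      rw [Equiv.symm_swap, Function.comp_apply, Equiv.swap_apply_def]
      split_ifs with ha hb
      · rw [ha, hij]
      · rw [hb, hij]
      · rfl
    rw [h2, Equiv.Perm.sign_swap hne] at h1
    simp at h1
    omega

theorem rename_schurPoly {n : ℕ} (lam : YoungDiagram) (σ : Equiv.Perm (Fin n)) :
    rename σ (schurPoly n lam) = schurPoly n lam := by
  by_cases h : lam.colLen 0 ≤ n
  · have h1 := isAlternating_alternant (addRho n lam) σ
    have h2 := isAlternating_alternant (fun j : Fin n => n - 1 - (j : ℕ)) σ
    rw [← delta_eq_alternant] at h2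
    rw [← delta_mul_schurPoly h, map_mul, h2, mul_assoc] at h1
    have hs : (C ((Equiv.Perm.sign σ : ℤˣ) : ℤ) : MvPolynomial (Fin n) ℤ) ≠ 0 := by simp
    exact mul_left_cancel₀ (delta_X_ne_zero n) (mul_left_cancel₀ hs h1)
  · rw [schurPoly_of_lt (not_le.1 h), map_zero]

theorem strictAnti_addRho (n : ℕ) (lam : YoungDiagram) : StrictAnti (addRho n lam) := by
  intro i j hij
  have := lam.rowLen_anti i j hij.le
  have := j.2
  have : (i : ℕ) < j := hij
  simp only [addRho]
  omega

theorem addRho_injective {n : ℕ} {lam kap : YoungDiagram} (hl : lam.colLen 0 ≤ n)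
    (hk : kap.colLen 0 ≤ n) (h : addRho n lam = addRho n kap) : lam = kap := by
  apply ext_rowLen
  intro i
  by_cases hi : i < n
  · have := congrFun h ⟨i, hi⟩
    simpa [addRho] using this
  · rw [(rowLen_eq_zero_iff _ _).2 (by omega), (rowLen_eq_zero_iff _ _).2 (by omega)]

theorem exists_addRho_eq {n : ℕ} {β : Fin n → ℕ} (hβ : StrictAnti β) :
    ∃ lam : YoungDiagram, lam.colLen 0 ≤ n ∧ addRho n lam = β := by
  have hge : ∀ i j : Fin n, i ≤ j → β j + (j - i : ℕ) ≤ β i := by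
    intro i j hij
    obtain ⟨d, hd⟩ := Nat.exists_eq_add_of_le (Fin.le_def.1 hij)
    induction d generalizing j with
    | zero =>
      have : j = i := Fin.ext (by omega)
      subst this
      omega
    | succ d ih =>
      have h1 := ih ⟨i + d, by omega⟩ (Fin.le_def.2 (by simp)) rfl
      have h2 : β j < β ⟨i + d, by omega⟩ := hβ (Fin.lt_def.2 (by simp; omega))
      simp at h1
      omega
  let f : ℕ → ℕ := fun i => if h : i < n then β ⟨i, h⟩ - (n - 1 - i) else 0
  have hf : IsPartSeq f := by
    refine ⟨fun i j hij => ?_, n, by simp [f]⟩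
    simp only [f]
    split_ifs with h1 h2
    · have := hge ⟨i, h2⟩ ⟨j, h1⟩ hij
      simp at this
      omega
    · omega
    · exact Nat.zero_le _
    · exact le_rfl
  refine ⟨ofParts f, ?_, ?_⟩
  · rw [← rowLen_eq_zero_iff, rowLen_ofParts hf]
    simp [f]
  · ext i
    have h1 := hge i ⟨n - 1, by have := i.2; omega⟩ (Fin.le_def.2 (by have := i.2; simp; omega))
    simp at h1
    simp [addRho, rowLen_ofParts hf, f]
    omega

/-- Auxiliary: the coefficient of `X ^ (lam + ρ_n)` in `Δ(X) s_mu(X) s_nu(X)`. -/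
def coeffIn (n : ℕ) (mu nu lam : YoungDiagram) : ℤ :=
  coeff (toExp (addRho n lam)) (delta X * schurPoly n mu * schurPoly n nu)

theorem schurPoly_mul_aux {n : ℕ} {mu nu : YoungDiagram} (s : Finset YoungDiagram)
    (hs : ∀ lam, lam.colLen 0 ≤ n → coeffIn n mu nu lam ≠ 0 → lam ∈ s) :
    schurPoly n mu * schurPoly n nu = ∑ lam ∈ s, C (coeffIn n mu nu lam) * schurPoly n lam := by
  classical
  apply mul_left_cancel₀ (delta_X_ne_zero n)
  rw [← sub_eq_zero]
  have hd := isAlternating_alternant (fun j : Fin n => n - 1 - (j : ℕ))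
  rw [← delta_eq_alternant] at hd
  apply IsAlternating.eq_zero
  · intro σ
    simp only [map_sub, map_mul, map_sum, hd σ, rename_schurPoly, rename_C]
    ring
  · intro β hβ
    obtain ⟨lam, hlam, rfl⟩ := exists_addRho_eq hβ
    have h1 : ∀ kap ∈ s, coeff (toExp (addRho n lam))
        (delta X * (C (coeffIn n mu nu kap) * schurPoly n kap)) =
        if kap = lam then coeffIn n mu nu lam else 0 := by
      intro kap _
      rw [mul_left_comm, coeff_C_mul]
      by_cases hk : kap.colLen 0 ≤ n
      · rw [delta_mul_schurPoly hk, coeff_alternant (strictAnti_addRho _ _) hβ]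
        by_cases h : kap = lam
        · simp [h]
        · rw [if_neg h, if_neg (fun he => h (addRho_injective hk hlam he)), mul_zero]
      · rw [schurPoly_of_lt (not_le.1 hk), mul_zero, coeff_zero, mul_zero, if_neg]
        rintro rfl
        exact hk hlam
    rw [coeff_sub, ← mul_assoc, Finset.mul_sum, coeff_sum, Finset.sum_congr rfl h1,
      Finset.sum_ite_eq']
    split_ifs with h
    · exact sub_self _
    · rw [sub_zero]
      by_contra hne
      exact h (hs lam hlam hne)


/-- Setting the last variable equal to zero. -/
def dropLast (n : ℕ) : MvPolynomial (Fin (n + 1)) ℤ →ₐ[ℤ] MvPolynomial (Fin n) ℤ :=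
  aeval (Fin.snoc X 0)

theorem coeff_dropLast {n : ℕ} (α : Fin n → ℕ) (P : MvPolynomial (Fin (n + 1)) ℤ) :
    coeff (toExp α) (dropLast n P) = coeff (toExp (Fin.snoc α 0 : Fin (n + 1) → ℕ)) P := by
  induction P using MvPolynomial.induction_on' with
  | monomial d a =>
    obtain ⟨β, rfl⟩ : ∃ β, toExp β = d := ⟨d, by ext; rfl⟩
    rw [monomial_toExp, map_mul, map_prod, ← monomial_toExp, coeff_monomial,
      Fin.prod_univ_castSucc]
    simp only [dropLast, map_pow, aeval_X, Fin.snoc_castSucc, Fin.snoc_last, algHom_C,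
      algebraMap_eq]
    rw [← mul_assoc, ← monomial_toExp fun i : Fin n => β i.castSucc]
    by_cases hb : β (Fin.last n) = 0
    · rw [hb, pow_zero, mul_one, coeff_monomial]
      congr 1
      apply propext
      constructor
      · intro h
        have h : (fun i : Fin n => β i.castSucc) = α := Finsupp.equivFunOnFinite.symm.injective h
        congr 1
        ext i
        refine Fin.lastCases ?_ (fun j => ?_) i
        · simp [hb]
        · simp [← h]
      · intro h
        have h : β = (Fin.snoc α 0 : Fin (n + 1) → ℕ) :=
          Finsupp.equivFunOnFinite.symm.injective h
        congr 1
        ext i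
        simp [h]
    · rw [zero_pow hb, mul_zero, coeff_zero, if_neg]
      intro h
      have h : β = (Fin.snoc α 0 : Fin (n + 1) → ℕ) :=
        Finsupp.equivFunOnFinite.symm.injective h
      simp [h] at hb
  | add p q hp hq => rw [map_add, coeff_add, coeff_add, hp, hq]

theorem dropLast_alternant (n : ℕ) (lam : YoungDiagram) :
    dropLast n (alternant (addRho (n + 1) lam)) =
      0 ^ lam.rowLen n * ((∏ i, X i) * alternant (addRho n lam)) := by
  rw [alternant, AlgHom.map_det, Matrix.det_succ_row _ (Fin.last n),
    Finset.sum_eq_single (Fin.last n)]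
  · have h1 : ((dropLast n).mapMatrix (Matrix.of fun i j =>
        (X i : MvPolynomial (Fin (n + 1)) ℤ) ^ addRho (n + 1) lam j)).submatrix
        (Fin.last n).succAbove (Fin.last n).succAbove =
        Matrix.of fun i j => X i * (Matrix.of fun i j =>
          (X i : MvPolynomial (Fin n) ℤ) ^ addRho n lam j) i j := by
      ext i j : 2
      have : addRho (n + 1) lam j.castSucc = addRho n lam j + 1 := by
        have := j.2
        simp [addRho]
        omega
      simp [dropLast, this, pow_succ']
    rw [h1, Matrix.det_mul_column, alternant]
    have h2 : addRho (n + 1) lam (Fin.last n) = lam.rowLen n := by simp [addRho]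
    simp [dropLast, h2]
  · intro j _ hj
    have : addRho (n + 1) lam j ≠ 0 := by
      have : (j : ℕ) ≠ n := fun h => hj (Fin.ext h)
      have := j.2
      simp [addRho]
      omega
    simp [dropLast, zero_pow this]
  · simp

theorem addRho_bot (n : ℕ) : addRho n ⊥ = fun j : Fin n => n - 1 - (j : ℕ) := by
  ext j
  have : (⊥ : YoungDiagram).rowLen j = 0 := by
    rw [YoungDiagram.rowLen_eq_card]
    simp [YoungDiagram.row]
  simp [addRho, this]

theorem dropLast_delta (n : ℕ) :
    dropLast n (delta X) = (∏ i, X i) * delta X := by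
  have : (⊥ : YoungDiagram).rowLen n = 0 := by
    rw [YoungDiagram.rowLen_eq_card]
    simp [YoungDiagram.row]
  rw [delta_eq_alternant, ← addRho_bot, dropLast_alternant, this, pow_zero, one_mul,
    delta_eq_alternant, addRho_bot]

theorem prod_X_ne_zero (n : ℕ) : (∏ i, X i : MvPolynomial (Fin n) ℤ) ≠ 0 :=
  Finset.prod_ne_zero_iff.2 fun i _ => X_ne_zero i

theorem dropLast_schurPoly (n : ℕ) (lam : YoungDiagram) :
    dropLast n (schurPoly (n + 1) lam) = schurPoly n lam := by
  by_cases h : lam.colLen 0 ≤ n + 1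
  · have h1 := congrArg (dropLast n) (delta_mul_schurPoly h)
    rw [map_mul, dropLast_delta, dropLast_alternant] at h1
    apply mul_left_cancel₀ (mul_ne_zero (prod_X_ne_zero n) (delta_X_ne_zero n))
    rw [h1]
    by_cases h' : lam.colLen 0 ≤ n
    · rw [(rowLen_eq_zero_iff _ _).2 h', mul_assoc, delta_mul_schurPoly h', pow_zero, one_mul]
    · rw [schurPoly_of_lt (not_le.1 h'), zero_pow, zero_mul, mul_zero]
      rwa [Ne, rowLen_eq_zero_iff]
  · rw [schurPoly_of_lt (not_le.1 h), schurPoly_of_lt (by omega), map_zero]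

theorem coeffIn_succ {n : ℕ} {mu nu lam : YoungDiagram} (h : lam.colLen 0 ≤ n) :
    coeffIn (n + 1) mu nu lam = coeffIn n mu nu lam := by
  have h1 : addRho (n + 1) lam = (Fin.snoc (fun j => 1 + addRho n lam j) 0 : Fin (n + 1) → ℕ) := by
    ext i
    refine Fin.lastCases ?_ (fun j => ?_) i
    · simp [addRho, (rowLen_eq_zero_iff _ _).2 h]
    · have := j.2
      simp [addRho]
      omega
  have h2 : toExp (fun j => 1 + addRho n lam j) = toExp (fun _ => 1) + toExp (addRho n lam) := by
    ext j
    rfl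
  have h3 : (∏ i, X i : MvPolynomial (Fin n) ℤ) = monomial (toExp fun _ => 1) 1 := by
    simp [monomial_toExp]
  rw [coeffIn, h1, ← coeff_dropLast, map_mul, map_mul, dropLast_delta, dropLast_schurPoly,
    dropLast_schurPoly, h2, h3, mul_assoc, mul_assoc, coeff_monomial_mul, one_mul, coeffIn,
    mul_assoc]

theorem coeffIn_eq {n : ℕ} {mu nu lam : YoungDiagram} (h : lam.colLen 0 ≤ n) :
    coeffIn n mu nu lam = coeffIn (lam.colLen 0) mu nu lam := by
  induction n, h using Nat.le_induction with
  | base => rfl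
  | succ n hn ih => rw [coeffIn_succ hn, ih]

theorem card_eq_sum_rowLen {n : ℕ} {lam : YoungDiagram} (h : lam.colLen 0 ≤ n) :
    lam.card = ∑ i : Fin n, lam.rowLen i := by
  rw [Fin.sum_univ_eq_sum_range lam.rowLen, YoungDiagram.card,
    Finset.card_eq_sum_card_fiberwise (f := Prod.fst) (t := Finset.range n)]
  · refine Finset.sum_congr rfl fun i _ => ?_
    rw [YoungDiagram.rowLen_eq_card]
    rfl
  · rintro ⟨i, j⟩ hij
    have h1 : (i, 0) ∈ lam := lam.up_left_mem le_rfl (Nat.zero_le j) hij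
    rw [YoungDiagram.mem_iff_lt_colLen] at h1
    simpa using h1.trans_le h

theorem isHomogeneous_alternant {n : ℕ} (α : Fin n → ℕ) :
    (alternant α).IsHomogeneous (∑ i, α i) := by
  rw [alternant_eq_sum]
  refine IsHomogeneous.sum _ _ _ fun σ _ => isHomogeneous_monomial _ ?_
  rw [Finsupp.degree_eq_sum]
  exact Fintype.sum_equiv σ.symm _ _ fun i => rfl

theorem isHomogeneous_of_mul {n a b : ℕ} {P Q : MvPolynomial (Fin n) ℤ} (hP : P.IsHomogeneous a)
    (hP0 : P ≠ 0) (h : (P * Q).IsHomogeneous (a + b)) : Q.IsHomogeneous b := by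
  let _ : GradedRing (homogeneousSubmodule (Fin n) ℤ) := gradedAlgebra
  have h1 := DirectSum.coe_decompose_mul_add_of_left_mem (homogeneousSubmodule (Fin n) ℤ)
    (a := P) (b := Q) (i := a) (j := b) hP
  rw [DirectSum.decompose_of_mem_same (homogeneousSubmodule (Fin n) ℤ) h] at h1
  rw [mul_left_cancel₀ hP0 h1]
  exact (DirectSum.decompose (homogeneousSubmodule (Fin n) ℤ) Q b).2

theorem isHomogeneous_delta (n : ℕ) : (delta (X : Fin n → MvPolynomial (Fin n) ℤ)).IsHomogeneous
    (∑ j : Fin n, (n - 1 - (j : ℕ))) := by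
  rw [delta_eq_alternant]
  exact isHomogeneous_alternant _

theorem sum_addRho {n : ℕ} {lam : YoungDiagram} (h : lam.colLen 0 ≤ n) :
    ∑ j, addRho n lam j = ∑ j : Fin n, (n - 1 - (j : ℕ)) + lam.card := by
  rw [card_eq_sum_rowLen h, ← Finset.sum_add_distrib]
  exact Finset.sum_congr rfl fun j _ => add_comm _ _

theorem isHomogeneous_schurPoly (n : ℕ) (lam : YoungDiagram) :
    (schurPoly n lam).IsHomogeneous lam.card := by
  by_cases h : lam.colLen 0 ≤ n
  · apply isHomogeneous_of_mul (isHomogeneous_delta n) (delta_X_ne_zero n)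
    rw [delta_mul_schurPoly h, ← sum_addRho h]
    exact isHomogeneous_alternant _
  · rw [schurPoly_of_lt (not_le.1 h)]
    exact isHomogeneous_zero _ _ _

theorem card_eq_of_coeffIn_ne_zero {n : ℕ} {mu nu lam : YoungDiagram} (h : lam.colLen 0 ≤ n)
    (hc : coeffIn n mu nu lam ≠ 0) : lam.card = mu.card + nu.card := by
  have h1 := (((isHomogeneous_delta n).mul (isHomogeneous_schurPoly n mu)).mul
    (isHomogeneous_schurPoly n nu))
  by_contra hne
  apply hc
  apply h1.coeff_eq_zero
  rw [Finsupp.degree_eq_sum]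
  have h2 : ∑ i, toExp (addRho n lam) i = ∑ j, addRho n lam j := rfl
  rw [h2, sum_addRho h]
  omega

theorem finite_card_le (d : ℕ) : {lam : YoungDiagram | lam.card ≤ d}.Finite := by
  apply Set.Finite.of_finite_image (f := YoungDiagram.cells)
  · apply (Finset.range d ×ˢ Finset.range d).powerset.finite_toSet.subset
    rintro _ ⟨lam, hlam, rfl⟩
    simp only [Finset.coe_powerset, Set.mem_preimage, Set.mem_powerset_iff]
    rintro ⟨i, j⟩ hij
    have hij : (i, j) ∈ lam := hij
    have h1 : lam.rowLen i ≤ d := by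
      rw [YoungDiagram.rowLen_eq_card]
      exact (Finset.card_le_card (Finset.filter_subset _ _)).trans hlam
    have h2 : lam.colLen j ≤ d := by
      rw [YoungDiagram.colLen_eq_card]
      exact (Finset.card_le_card (Finset.filter_subset _ _)).trans hlam
    have h3 := YoungDiagram.mem_iff_lt_rowLen.1 hij
    have h4 := YoungDiagram.mem_iff_lt_colLen.1 hij
    simp
    omega
  · intro a _ b _ h
    exact YoungDiagram.ext h

theorem exists_lrCoeff (mu nu : YoungDiagram) : ∃ c : YoungDiagram →₀ ℤ,
    ∀ n, schurPoly n mu * schurPoly n nu = ∑ lam ∈ c.support, C (c lam) * schurPoly n lam := by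
  classical
  refine ⟨Finsupp.onFinset (finite_card_le (mu.card + nu.card)).toFinset
    (fun lam => coeffIn (lam.colLen 0) mu nu lam) ?_, fun n => ?_⟩
  · intro lam h
    simpa using (card_eq_of_coeffIn_ne_zero le_rfl h).le
  · rw [schurPoly_mul_aux (finite_card_le (mu.card + nu.card)).toFinset]
    · symm
      apply Finset.sum_subset_zero_on_sdiff
      · exact Finsupp.support_onFinset_subset
      · intro lam hlam
        rw [Finset.mem_sdiff, Finsupp.notMem_support_iff] at hlam
        by_cases h : lam.colLen 0 ≤ n
        · rw [coeffIn_eq h]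
          have := hlam.2
          rw [Finsupp.onFinset_apply] at this
          rw [this]
          simp
        · rw [schurPoly_of_lt (not_le.1 h), mul_zero]
      · intro lam _
        by_cases h : lam.colLen 0 ≤ n
        · rw [coeffIn_eq h, Finsupp.onFinset_apply]
        · rw [schurPoly_of_lt (not_le.1 h), mul_zero, mul_zero]
    · intro lam h hc
      simpa using (card_eq_of_coeffIn_ne_zero h hc).le

/-- The Littlewood-Richardson coefficient `c^lam_{mu nu}`: the coefficients of the expansion
`s_mu s_nu = ∑_lam c^lam_{mu nu} s_lam`, valid in any number of variables. -/
def lrCoeff (lam mu nu : YoungDiagram) : ℤ := (exists_lrCoeff mu nu).choose lam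

theorem schurPoly_mul_schurPoly (n : ℕ) (mu nu : YoungDiagram) :
    schurPoly n mu * schurPoly n nu =
      ∑ᶠ lam : YoungDiagram, C (lrCoeff lam mu nu) * schurPoly n lam := by
  rw [(exists_lrCoeff mu nu).choose_spec n]
  symm
  apply finsum_eq_sum_of_support_subset
  intro lam h
  rw [Function.mem_support] at h
  rw [Finset.mem_coe, Finsupp.mem_support_iff]
  intro h0
  apply h
  rw [lrCoeff, h0]
  simp


theorem lrCoeff_eq_coeffIn {n : ℕ} {mu nu lam : YoungDiagram} (h : lam.colLen 0 ≤ n) :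
    lrCoeff lam mu nu = coeffIn n mu nu lam := by
  classical
  rw [coeffIn, mul_assoc, (exists_lrCoeff mu nu).choose_spec n, Finset.mul_sum, coeff_sum, lrCoeff]
  set c := (exists_lrCoeff mu nu).choose
  have h1 : ∀ kap ∈ c.support, coeff (toExp (addRho n lam))
      (delta X * (C (c kap) * schurPoly n kap)) = if kap = lam then c lam else 0 := by
    intro kap _
    rw [mul_left_comm, coeff_C_mul]
    by_cases hk : kap.colLen 0 ≤ n
    · rw [delta_mul_schurPoly hk, coeff_alternant (strictAnti_addRho _ _) (strictAnti_addRho _ _)]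
      by_cases h' : kap = lam
      · simp [h']
      · rw [if_neg h', if_neg (fun he => h' (addRho_injective hk h he)), mul_zero]
    · rw [schurPoly_of_lt (not_le.1 hk), mul_zero, coeff_zero, mul_zero, if_neg]
      rintro rfl
      exact hk h
  rw [Finset.sum_congr rfl h1, Finset.sum_ite_eq']
  split_ifs with h2
  · rfl
  · exact Finsupp.notMem_support_iff.1 h2

theorem card_eq_of_lrCoeff_ne_zero {mu nu lam : YoungDiagram} (h : lrCoeff lam mu nu ≠ 0) :
    lam.card = mu.card + nu.card := by
  rw [lrCoeff_eq_coeffIn le_rfl] at h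
  exact card_eq_of_coeffIn_ne_zero le_rfl h

theorem finite_lrCoeff_ne_zero (lam : YoungDiagram) :
    {q : YoungDiagram × YoungDiagram | lrCoeff lam q.1 q.2 ≠ 0}.Finite := by
  refine ((finite_card_le lam.card).prod (finite_card_le lam.card)).subset fun q hq => ?_
  have := card_eq_of_lrCoeff_ne_zero hq
  constructor
  · show q.1.card ≤ lam.card
    omega
  · show q.2.card ≤ lam.card
    omega

/-- The Schur function `s_lam(x)` evaluated at a sequence of elements of a commutative ring,
repetitions allowed. -/
def schur {R : Type*} [CommRing R] (lam : YoungDiagram) {n : ℕ} (x : Fin n → R) : R :=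
  aeval x (schurPoly n lam)

/-- The Littlewood-Schur function
`LS_lam(x; y) = ∑_{mu, nu} c^lam_{mu nu} s_mu(x) s_{nu'}(y)`. Only finitely many coefficients are
nonzero, see `finite_lrCoeff_ne_zero`. -/
def LS {R : Type*} [CommRing R] (lam : YoungDiagram) {a b : ℕ} (x : Fin a → R) (y : Fin b → R) :
    R :=
  ∑ᶠ q : YoungDiagram × YoungDiagram,
    (lrCoeff lam q.1 q.2 : R) * schur q.1 x * schur q.2.transpose y

/-- The point `(i, j)` lies in the Ferrers diagram `{(i, j) : 1 ≤ j, 1 ≤ i ≤ λ_j}`. -/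
def InFerrers (lam : YoungDiagram) (i j : ℤ) : Prop :=
  1 ≤ i ∧ 1 ≤ j ∧ i ≤ lam.rowLen (j - 1).toNat

/-- `k` is the `(m,n)`-index of `lam`: the largest integer `k ≤ min {m, n}` such that
`(m + 1 - k, n + 1 - k)` is not in the Ferrers diagram of `lam`. -/
def IsIndex (m n : ℕ) (lam : YoungDiagram) (k : ℤ) : Prop :=
  IsGreatest {k : ℤ | k ≤ min (m : ℤ) n ∧ ¬InFerrers lam (m + 1 - k) (n + 1 - k)} k

/-- `mu` and `nu` have length at most `a` and `b`, and the permutation `σ` sorts the concatenation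
of `mu + ρ_a` and `nu + ρ_b` into `kap + ρ_{a+b}`. -/
def IsSorting (a b : ℕ) (mu nu kap : YoungDiagram) (σ : Equiv.Perm (Fin (a + b))) : Prop :=
  mu.colLen 0 ≤ a ∧ nu.colLen 0 ≤ b ∧ kap.colLen 0 ≤ a + b ∧
    ∀ i, Fin.append (addRho a mu) (addRho b nu) i = addRho (a + b) kap (σ i)

/-- `kap` is the `(a,b)`-overlap of `mu` and `nu`. -/
def IsOverlap (a b : ℕ) (mu nu kap : YoungDiagram) : Prop := ∃ σ, IsSorting a b mu nu kap σ

open Classical in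
/-- The sign `ε_{a,b}(mu, nu)` of the sorting permutation (which is unique, see `overlapSign_eq`)
if the `(a,b)`-overlap is a partition, and `1` otherwise. -/
def overlapSign (a b : ℕ) (mu nu : YoungDiagram) : ℤ :=
  if h : ∃ σ kap, IsSorting a b mu nu kap σ then ((Equiv.Perm.sign h.choose : ℤˣ) : ℤ) else 1

theorem IsSorting.unique {a b : ℕ} {mu nu kap kap' : YoungDiagram}
    {σ σ' : Equiv.Perm (Fin (a + b))} (h : IsSorting a b mu nu kap σ)
    (h' : IsSorting a b mu nu kap' σ') : kap = kap' ∧ σ = σ' := by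
  have e : ∀ i, addRho (a + b) kap (σ i) = addRho (a + b) kap' (σ' i) := fun i =>
    (h.2.2.2 i).symm.trans (h'.2.2.2 i)
  have h1 : (OrderDual.toDual ∘ addRho (a + b) kap) = OrderDual.toDual ∘ addRho (a + b) kap' := by
    have s1 : StrictMono (OrderDual.toDual ∘ addRho (a + b) kap) :=
      fun i j hij => strictAnti_addRho (a + b) kap hij
    have s2 : StrictMono (OrderDual.toDual ∘ addRho (a + b) kap') :=
      fun i j hij => strictAnti_addRho (a + b) kap' hij
    rw [← s1.range_inj s2]
    refine (EquivLike.range_comp _ σ).symm.trans (Eq.trans ?_ (EquivLike.range_comp _ σ'))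
    congr 1
    ext i
    exact e i
  have h2 : kap = kap' := addRho_injective h.2.2.1 h'.2.2.1 h1
  subst h2
  exact ⟨rfl, Equiv.ext fun i => (strictAnti_addRho _ _).injective (e i)⟩

theorem overlapSign_eq {a b : ℕ} {mu nu kap : YoungDiagram} {σ : Equiv.Perm (Fin (a + b))}
    (h : IsSorting a b mu nu kap σ) :
    overlapSign a b mu nu = ((Equiv.Perm.sign σ : ℤˣ) : ℤ) := by
  have he : ∃ σ kap, IsSorting a b mu nu kap σ := ⟨σ, kap, h⟩
  rw [overlapSign, dif_pos he, (he.choose_spec.choose_spec.unique h).2]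

theorem finite_isOverlap (a b : ℕ) (kap : YoungDiagram) :
    {q : YoungDiagram × YoungDiagram | IsOverlap a b q.1 q.2 kap}.Finite := by
  have hf := finite_card_le (∑ i, addRho (a + b) kap i)
  refine (hf.prod hf).subset ?_
  rintro ⟨mu, nu⟩ ⟨σ, h1, h2, -, h3⟩
  have h4 : ∑ i, Fin.append (addRho a mu) (addRho b nu) i = ∑ i, addRho (a + b) kap i := by
    rw [← Equiv.sum_comp σ (addRho (a + b) kap)]
    exact Finset.sum_congr rfl fun i _ => h3 i
  rw [Fin.sum_univ_add] at h4
  simp only [Fin.append_left, Fin.append_right, sum_addRho h1, sum_addRho h2] at h4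
  constructor
  · show mu.card ≤ _
    omega
  · show nu.card ≤ _
    omega

/-- `(λ_1, …, λ_r)`. -/
def takeRows (r : ℕ) (lam : YoungDiagram) : YoungDiagram :=
  ofParts fun i => if i < r then lam.rowLen i else 0

/-- `(λ_{r+1}, λ_{r+2}, …)`. -/
def dropRows (r : ℕ) (lam : YoungDiagram) : YoungDiagram :=
  ofParts fun i => lam.rowLen (r + i)

/-- The union `nu ∪ kap` of sequences, `nu` being regarded as a sequence of length `b`: the sequence
`(nu_1, …, nu_b, kap_1, kap_2, …)`. It is a partition wherever it is used below, see
`IsOverlap.rowLen_concat`. -/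
def concat (b : ℕ) (nu kap : YoungDiagram) : YoungDiagram :=
  ofParts fun i => if i < b then nu.rowLen i else kap.rowLen (i - b)

/-- `mu - ⟨c^a⟩`: each of the parts `mu_1, …, mu_a` is decreased by `c`. No truncation takes place
wherever it is used below, see `IsOverlap.rowLen_subRect`. -/
def subRect (mu : YoungDiagram) (c a : ℕ) : YoungDiagram :=
  ofParts fun i => if i < a then mu.rowLen i - c else mu.rowLen i

/-- The subsequence of `y` consisting of the entries with index in `A`. -/
def subseq {R : Type*} {m : ℕ} (y : Fin m → R) (A : Finset (Fin m)) : Fin A.card → R :=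
  y ∘ A.orderEmbOfFin rfl

theorem rowLen_takeRows (r : ℕ) (lam : YoungDiagram) (i : ℕ) :
    (takeRows r lam).rowLen i = if i < r then lam.rowLen i else 0 := by
  refine rowLen_ofParts ⟨fun i j hij => ?_, r, by simp⟩ i
  have := lam.rowLen_anti i j hij
  split_ifs <;> omega

theorem rowLen_dropRows (r : ℕ) (lam : YoungDiagram) (i : ℕ) :
    (dropRows r lam).rowLen i = lam.rowLen (r + i) := by
  refine rowLen_ofParts ⟨fun i j hij => lam.rowLen_anti _ _ (by omega), lam.colLen 0, ?_⟩ i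
  rw [rowLen_eq_zero_iff]
  omega

theorem IsOverlap.le_left {a b : ℕ} {mu nu lam : YoungDiagram}
    (h : IsOverlap a b mu nu (takeRows (a + b) lam)) {i : ℕ} (hi : i < a) :
    lam.rowLen (a + b - 1) ≤ mu.rowLen i := by
  obtain ⟨σ, -, -, -, h⟩ := h
  have h1 := h (Fin.castAdd b ⟨a - 1, by omega⟩)
  rw [Fin.append_left] at h1
  have h2 := (σ (Fin.castAdd b ⟨a - 1, by omega⟩)).2
  simp only [addRho, rowLen_takeRows, if_pos h2] at h1
  have h3 := lam.rowLen_anti (σ (Fin.castAdd b ⟨a - 1, by omega⟩)) (a + b - 1) (by omega)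
  have h4 := mu.rowLen_anti i (a - 1) (by omega)
  omega

theorem IsOverlap.le_right {a b : ℕ} {mu nu lam : YoungDiagram}
    (h : IsOverlap a b mu nu (takeRows (a + b) lam)) {i : ℕ} (hi : i < b) :
    lam.rowLen (a + b - 1) ≤ nu.rowLen i := by
  obtain ⟨σ, -, -, -, h⟩ := h
  have h1 := h (Fin.natAdd a ⟨b - 1, by omega⟩)
  rw [Fin.append_right] at h1
  have h2 := (σ (Fin.natAdd a ⟨b - 1, by omega⟩)).2
  simp only [addRho, rowLen_takeRows, if_pos h2] at h1
  have h3 := lam.rowLen_anti (σ (Fin.natAdd a ⟨b - 1, by omega⟩)) (a + b - 1) (by omega)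
  have h4 := nu.rowLen_anti i (b - 1) (by omega)
  omega

theorem IsOverlap.rowLen_concat {a b : ℕ} {mu nu lam : YoungDiagram}
    (h : IsOverlap a b mu nu (takeRows (a + b) lam)) (i : ℕ) :
    (concat b nu (dropRows (a + b) lam)).rowLen i =
      if i < b then nu.rowLen i else lam.rowLen (a + i) := by
  rw [concat, rowLen_ofParts]
  · split_ifs
    · rfl
    · rw [rowLen_dropRows]
      congr 1
      omega
  · refine ⟨fun i j hij => ?_, b + lam.colLen 0, ?_⟩
    · simp only [rowLen_dropRows]
      split_ifs with h1 h2 h2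
      · exact nu.rowLen_anti _ _ hij
      · omega
      · exact (lam.rowLen_anti _ _ (by omega)).trans (h.le_right h2)
      · exact lam.rowLen_anti _ _ (by omega)
    · dsimp only
      rw [if_neg (by omega), rowLen_dropRows, rowLen_eq_zero_iff]
      omega

theorem IsIndex.le_rowLen {m n : ℕ} {lam : YoungDiagram} {k : ℤ} (h : IsIndex m n lam k)
    (hr : 0 < (n - k).toNat) : (m - k).toNat ≤ lam.rowLen ((n - k).toNat - 1) := by
  by_contra hc
  have h1 : k + 1 ∈ {k : ℤ | k ≤ min (m : ℤ) n ∧ ¬InFerrers lam (m + 1 - k) (n + 1 - k)} := by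
    refine ⟨by omega, fun ⟨h2, h3, h4⟩ => hc ?_⟩
    rw [show ((n : ℤ) + 1 - (k + 1) - 1).toNat = (n - k).toNat - 1 by omega] at h4
    omega
  have := h.2 h1
  omega

theorem IsOverlap.rowLen_subRect {m n a b : ℕ} {mu nu lam : YoungDiagram} {k : ℤ}
    (hk : IsIndex m n lam k) (hr : (n - k).toNat = a + b)
    (h : IsOverlap a b mu nu (takeRows (n - k).toNat lam)) (i : ℕ) :
    ((subRect mu (m - k).toNat a).rowLen i : ℤ) = mu.rowLen i - if i < a then (m - k) else 0 := by
  have hkm := hk.1.1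
  rw [hr] at h
  have h0 : ∀ i, a ≤ i → mu.rowLen i = 0 := fun i hi => by
    rw [rowLen_eq_zero_iff]
    exact h.choose_spec.1.trans hi
  rw [subRect, rowLen_ofParts]
  · split_ifs with hi
    · have h1 := hk.le_rowLen (by omega)
      rw [hr] at h1
      have h2 := h.le_left hi
      omega
    · simp
  · refine ⟨fun i j hij => ?_, a, by simp [h0]⟩
    have := mu.rowLen_anti i j hij
    dsimp only
    split_ifs with h1 h2
    · omega
    · omega
    · rw [h0 j (by omega)]
      exact Nat.zero_le _
    · omega

end

end LittlewoodSchur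

open LittlewoodSchur

/-! The proof computes one determinant in two ways. By a Jacobi-Trudi formula (`LS_eq_jacobiDet`),
LS_λ(X; Y) is the determinant of the coefficients f_{λ_i - i + j} of f = ∏(1 + y z) / ∏(1 - x z).
Such coefficients are values of linear functionals u^b ↦ f_{k+b} on polynomials in u, and
multiplying the polynomial by u - w amounts to multiplying f by 1 - wz and raising k by one
(`shiftFunctional_X_sub_C_mul`).

Put s = -S, t = -T, w = -Y, s(u) = ∏(u - s_i), t(u) = ∏(u - t_i) and f = 1 / (∏(1 - s_i z) ∏(1 - t_i
z)). The rows of `overlapMatrix` are the evaluations at the w_i and the coefficient functionals of f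
belonging to the parts of λ; its columns are the multiples t(u)u^j for j < l and s(u)u^j for j < M.

On the one hand the matrix factors as (functionals on monomials) times (coefficients of the
columns). The first factor has determinant Δ(Y) LS_λ (`det_mixedFunctional`), the second is a
Sylvester matrix with determinant Δ(T; S) (`det_coeff_rootPoly`).

On the other hand, Laplace expansion along the two blocks of columns chooses l rows for the first
block: a set J of evaluations, which selects U, and a set I of parts of λ, which selects μ. On
multiples of t(u) the series f loses its t-factors, so the first minor is an LS function of (-S; U)
up to Δ(T; U) and a Vandermonde determinant; the second minor is likewise one of (-T; V). The pairs
(μ, ν) that arise are those with overlap λ_{[n-k]} (`sum_powersetCard_eq_finsum_isOverlap`).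

The index k enters twice. Since (m+1-k, n+1-k) is outside the diagram, the rows of the parts after
the first n - k vanish on the first block, so they always go to ν (`det_overlapMatrix_eq_sum`). By
maximality of k, the remaining parts are large enough to subtract m - k. The rest is sign
bookkeeping (`sign_blockEquiv`, `det_split_div_eq`). -/

namespace LittlewoodSchur

/-! ### Coefficient functionals on polynomials and their determinants -/

section Functionals

variable {R : Type*} [CommRing R]

/-- The coefficient of a power series at an integer, zero at negative integers. -/
noncomputable def coeffInt (f : PowerSeries R) (k : ℤ) : R :=
  if 0 ≤ k then PowerSeries.coeff k.toNat f else 0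

theorem coeffInt_natCast (f : PowerSeries R) (k : ℕ) : coeffInt f k = PowerSeries.coeff k f := by
  simp [coeffInt]

theorem coeffInt_of_neg (f : PowerSeries R) {k : ℤ} (h : k < 0) : coeffInt f k = 0 :=
  if_neg (not_le.2 h)

theorem coeffInt_one_sub_mul (w : R) (f : PowerSeries R) (k : ℤ) :
    coeffInt ((1 - PowerSeries.C w * PowerSeries.X) * f) k =
      coeffInt f k - w * coeffInt f (k - 1) := by
  rcases lt_trichotomy k 0 with h | rfl | h
  · rw [coeffInt_of_neg _ h, coeffInt_of_neg _ h, coeffInt_of_neg _ (by omega)]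
    simp
  · rw [coeffInt_of_neg f (show (0 : ℤ) - 1 < 0 by omega)]
    simp [coeffInt]
  · obtain ⟨n, rfl⟩ : ∃ n : ℕ, k = ((n + 1 : ℕ) : ℤ) := ⟨k.toNat - 1, by omega⟩
    rw [coeffInt_natCast, coeffInt_natCast,
      show ((n + 1 : ℕ) : ℤ) - 1 = (n : ℤ) by push_cast; ring, coeffInt_natCast, sub_mul, one_mul,
      map_sub, mul_assoc, PowerSeries.coeff_C_mul, PowerSeries.coeff_succ_X_mul]

/-- The linear functional on polynomials that maps `X ^ b` to the coefficient of `f` at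
`k + b`. -/
noncomputable def shiftFunctional (f : PowerSeries R) (k : ℤ) : Polynomial R →ₗ[R] R :=
  Polynomial.lsum fun b => coeffInt f (k + b) • LinearMap.id

theorem shiftFunctional_X_pow (f : PowerSeries R) (k : ℤ) (b : ℕ) :
    shiftFunctional f k (Polynomial.X ^ b) = coeffInt f (k + b) := by
  rw [shiftFunctional, Polynomial.lsum_apply, Polynomial.X_pow_eq_monomial,
    Polynomial.sum_monomial_index] <;> simp

/-- On u^b both sides are f_{k+b+1} - w f_{k+b}. This exchange of a root of the polynomial for a
factor of the series drives every determinant evaluation below. -/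
theorem shiftFunctional_X_sub_C_mul (f : PowerSeries R) (k : ℤ) (w : R) (Q : Polynomial R) :
    shiftFunctional f k ((Polynomial.X - Polynomial.C w) * Q) =
      shiftFunctional ((1 - PowerSeries.C w * PowerSeries.X) * f) (k + 1) Q := by
  induction Q using Polynomial.induction_on' with
  | add p q hp hq => rw [mul_add, map_add, map_add, hp, hq]
  | monomial b a =>
    rw [← Polynomial.C_mul_X_pow_eq_monomial, ← Polynomial.smul_eq_C_mul, mul_smul_comm,
      map_smul, map_smul, sub_mul, ← pow_succ', ← Polynomial.smul_eq_C_mul, map_sub, map_smul,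
      shiftFunctional_X_pow, shiftFunctional_X_pow, shiftFunctional_X_pow, coeffInt_one_sub_mul]
    congr 3
    · push_cast
      ring_nf
    · ring_nf

/-- `∏ i, (u - w i)` as a polynomial in `u`. -/
noncomputable def rootPoly {ι : Type*} [Fintype ι] (w : ι → R) : Polynomial R :=
  ∏ i, (Polynomial.X - Polynomial.C (w i))

/-- `∏ i, (1 - w i * z)` as a power series in `z`. -/
noncomputable def oneSubProd {ι : Type*} [Fintype ι] (w : ι → R) : PowerSeries R :=
  ∏ i, (1 - PowerSeries.C (w i) * PowerSeries.X)

/-- `∏ i, (1 - x i * z)⁻¹` as a power series in `z`. -/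
noncomputable def geomProd {ι : Type*} [Fintype ι] (x : ι → R) : PowerSeries R :=
  ∏ i, PowerSeries.mk fun k => x i ^ k

theorem one_sub_mul_mk_pow (a : R) :
    (1 - PowerSeries.C a * PowerSeries.X) * PowerSeries.mk (fun k => a ^ k) = 1 := by
  ext k
  rw [sub_mul, one_mul, map_sub, mul_assoc, PowerSeries.coeff_C_mul]
  cases k with
  | zero => simp
  | succ k => simp [PowerSeries.coeff_succ_X_mul, pow_succ', PowerSeries.coeff_one]

theorem oneSubProd_mul_geomProd {ι : Type*} [Fintype ι] (x : ι → R) :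
    oneSubProd x * geomProd x = 1 := by
  rw [oneSubProd, geomProd, ← Finset.prod_mul_distrib]
  exact Finset.prod_eq_one fun i _ => one_sub_mul_mk_pow _

theorem shiftFunctional_prod_mul {ι : Type*} (s : Finset ι) (w : ι → R) (f : PowerSeries R)
    (k : ℤ) (Q : Polynomial R) :
    shiftFunctional f k ((∏ i ∈ s, (Polynomial.X - Polynomial.C (w i))) * Q) =
      shiftFunctional ((∏ i ∈ s, (1 - PowerSeries.C (w i) * PowerSeries.X)) * f)
        (k + s.card) Q := by
  classical
  induction s using Finset.induction_on generalizing f k with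
  | empty => simp
  | insert a s ha ih =>
    rw [Finset.prod_insert ha, mul_assoc, shiftFunctional_X_sub_C_mul, ih, Finset.prod_insert ha,
      Finset.card_insert_of_notMem ha]
    congr 2
    · ring
    · push_cast
      ring

theorem shiftFunctional_rootPoly_mul {ι : Type*} [Fintype ι] (w : ι → R) (f : PowerSeries R)
    (k : ℤ) (Q : Polynomial R) :
    shiftFunctional f k (rootPoly w * Q) =
      shiftFunctional (oneSubProd w * f) (k + Fintype.card ι) Q :=
  shiftFunctional_prod_mul Finset.univ w f k Q

theorem monic_rootPoly {ι : Type*} [Fintype ι] (w : ι → R) : (rootPoly w).Monic :=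
  Polynomial.monic_prod_X_sub_C w Finset.univ

theorem natDegree_rootPoly [Nontrivial R] {ι : Type*} [Fintype ι] (w : ι → R) :
    (rootPoly w).natDegree = Fintype.card ι :=
  Polynomial.natDegree_finsetProd_X_sub_C_eq_card Finset.univ w

theorem eval_rootPoly {ι : Type*} [Fintype ι] (w : ι → R) (a : R) :
    (rootPoly w).eval a = ∏ i, (a - w i) := by
  simp [rootPoly, Polynomial.eval_prod]

theorem linearMap_apply_eq_sum {M : ℕ} (ψ : Polynomial R →ₗ[R] R) {Q : Polynomial R}
    (hQ : Q.degree < M) : ψ Q = ∑ b : Fin M, ψ (Polynomial.X ^ (b : ℕ)) * Q.coeff b := by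
  rcases eq_or_ne Q 0 with rfl | h0
  · simp
  conv_lhs => rw [Q.as_sum_range_C_mul_X_pow' (n := M)
    ((Polynomial.natDegree_lt_iff_degree_lt h0).2 hQ)]
  rw [map_sum, ← Fin.sum_univ_eq_sum_range
    (fun b => ψ (Polynomial.C (Q.coeff b) * Polynomial.X ^ b))]
  refine Finset.sum_congr rfl fun b _ => ?_
  rw [← Polynomial.smul_eq_C_mul, map_smul, smul_eq_mul, mul_comm]

/-- The matrix of values of functionals on polynomials factors through the coefficients. -/
theorem det_functionals {M : ℕ} (ψ : Fin M → Polynomial R →ₗ[R] R) (Q : Fin M → Polynomial R)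
    (hQ : ∀ j, (Q j).degree < M) :
    (Matrix.of fun i j => ψ i (Q j)).det =
      (Matrix.of fun i b : Fin M => ψ i (Polynomial.X ^ (b : ℕ))).det *
        (Matrix.of fun b j : Fin M => (Q j).coeff b).det := by
  rw [← Matrix.det_mul]
  congr 1
  ext i j
  rw [Matrix.mul_apply]
  exact linearMap_apply_eq_sum (ψ i) (hQ j)

/-- The determinant of the coefficients `f_{α_i + j - (N - 1)}`; for `α = lam + ρ_N` this is the
Jacobi-Trudi determinant. -/
noncomputable def jacobiDet (f : PowerSeries R) {N : ℕ} (α : Fin N → ℕ) : R :=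
  (Matrix.of fun i j : Fin N => coeffInt f ((α i : ℤ) + j + 1 - N)).det

/-- Evaluation at `w` and the functionals of `shiftFunctional` at `α`. -/
noncomputable def mixedFunctional (M : ℕ) (f : PowerSeries R) {ι κ : Type*} (w : ι → R)
    (α : κ → ℕ) : ι ⊕ κ → Polynomial R →ₗ[R] R :=
  Sum.elim (fun i => Polynomial.leval (w i)) (fun k => shiftFunctional f ((α k : ℤ) + 1 - M))

/-- The determinant does not change if the monomials are replaced by another monic basis with the
same degrees. In the basis 1, …, u^{m-1}, w(u), w(u)u, … with w(u) = ∏(u - w_i), the evaluations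
kill the second part, and the matrix becomes block triangular. -/
theorem det_mixedFunctional {m N : ℕ} (f : PowerSeries R) (w : Fin m → R) (α : Fin N → ℕ) :
    (Matrix.of fun i b : Fin (m + N) =>
      mixedFunctional (m + N) f w α (finSumFinEquiv.symm i) (Polynomial.X ^ (b : ℕ))).det =
      (Matrix.vandermonde w).det * jacobiDet (oneSubProd w * f) α := by
  nontriviality R
  let Q : Fin (m + N) → Polynomial R := Fin.addCases (fun b : Fin m => Polynomial.X ^ (b : ℕ))
    (fun j : Fin N => rootPoly w * Polynomial.X ^ (j : ℕ))
  have hmon : ∀ j, (Q j).Monic := by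
    refine Fin.addCases (fun b => ?_) (fun j => ?_)
    · simp [Q]
    · simpa [Q] using (monic_rootPoly w).mul (Polynomial.monic_X_pow (j : ℕ))
  have hdeg : ∀ j, (Q j).natDegree = j := by
    refine Fin.addCases (fun b => ?_) (fun j => ?_)
    · simp [Q]
    · simp only [Q, Fin.addCases_right]
      rw [(monic_rootPoly w).natDegree_mul (Polynomial.monic_X_pow _), natDegree_rootPoly]
      simp
  have h := det_functionals (fun i => mixedFunctional (m + N) f w α (finSumFinEquiv.symm i)) Q
    (fun j => by
      rw [Polynomial.degree_eq_natDegree (hmon j).ne_zero, hdeg]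
      exact_mod_cast j.2)
  rw [Matrix.det_matrixOfPolynomials Q hdeg hmon, mul_one] at h
  rw [← h, ← Matrix.det_submatrix_equiv_self finSumFinEquiv]
  have hb : (Matrix.of fun i j : Fin (m + N) =>
        mixedFunctional (m + N) f w α (finSumFinEquiv.symm i) (Q j)).submatrix
        finSumFinEquiv finSumFinEquiv =
      Matrix.fromBlocks (Matrix.vandermonde w) 0
        (Matrix.of fun k b => shiftFunctional f ((α k : ℤ) + 1 - (m + N : ℕ))
          (Polynomial.X ^ (b : ℕ)))
        (Matrix.of fun i j : Fin N => coeffInt (oneSubProd w * f) ((α i : ℤ) + j + 1 - N)) := by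
    ext i j
    rcases i with i | i <;> rcases j with j | j
    · simp [mixedFunctional, Q, Matrix.vandermonde_apply]
    · simp only [mixedFunctional, Q, Matrix.submatrix_apply, Matrix.of_apply,
        Equiv.symm_apply_apply, finSumFinEquiv_apply_right, Fin.addCases_right, Sum.elim_inl,
        Polynomial.leval_apply, Polynomial.eval_mul, eval_rootPoly, Matrix.fromBlocks_apply₁₂,
        Matrix.zero_apply]
      -- Each w_i is a root of w(u): this is the zero block.
      rw [Finset.prod_eq_zero (Finset.mem_univ i) (sub_self _), zero_mul]
    · simp [mixedFunctional, Q]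
    · rw [Matrix.submatrix_apply, Matrix.of_apply, Equiv.symm_apply_apply, mixedFunctional,
        Sum.elim_inr, Matrix.fromBlocks_apply₂₂, Matrix.of_apply]
      simp only [Q, finSumFinEquiv_apply_right, Fin.addCases_right]
      -- The m roots raise the index from α_i + 1 - (m + N) to α_i + 1 - N, the shift in `jacobiDet`
      -- of size N.
      rw [shiftFunctional_rootPoly_mul, shiftFunctional_X_pow, Fintype.card_fin]
      congr 1
      push_cast
      ring
  rw [hb, Matrix.det_fromBlocks_zero₁₂, jacobiDet]

end Functionals

/-! ### The Jacobi-Trudi identity for Schur functions -/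

section JacobiTrudi

variable {R : Type*} [CommRing R]

theorem map_coeffInt {S : Type*} [CommRing S] (φ : R →+* S) (f : PowerSeries R) (k : ℤ) :
    φ (coeffInt f k) = coeffInt (PowerSeries.map φ f) k := by
  rw [coeffInt, coeffInt]
  split_ifs <;> simp

theorem map_jacobiDet {S : Type*} [CommRing S] (φ : R →+* S) (f : PowerSeries R) {N : ℕ}
    (α : Fin N → ℕ) : φ (jacobiDet f α) = jacobiDet (PowerSeries.map φ f) α := by
  rw [jacobiDet, RingHom.map_det, jacobiDet]
  congr 1
  ext i j
  simp [map_coeffInt]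

theorem map_geomProd {S : Type*} [CommRing S] (φ : R →+* S) {ι : Type*} [Fintype ι] (x : ι → R) :
    PowerSeries.map φ (geomProd x) = geomProd fun i => φ (x i) := by
  rw [geomProd, map_prod, geomProd]
  refine Finset.prod_congr rfl fun i _ => ?_
  ext k
  simp

theorem map_oneSubProd {S : Type*} [CommRing S] (φ : R →+* S) {ι : Type*} [Fintype ι]
    (x : ι → R) : PowerSeries.map φ (oneSubProd x) = oneSubProd fun i => φ (x i) := by
  simp [oneSubProd]

theorem constantCoeff_geomProd {ι : Type*} [Fintype ι] (x : ι → R) :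
    PowerSeries.coeff 0 (geomProd x) = 1 := by
  rw [geomProd, PowerSeries.coeff_zero_eq_constantCoeff_apply, map_prod]
  refine Finset.prod_eq_one fun i _ => ?_
  rw [← PowerSeries.coeff_zero_eq_constantCoeff_apply]
  simp

theorem coeffInt_zero_of_coeff {f : PowerSeries R} (hf : PowerSeries.coeff 0 f = 1) :
    coeffInt f 0 = 1 := by
  simpa [coeffInt] using hf

/-- The entries are f_{j-i}, so the matrix is unitriangular. -/
theorem jacobiDet_rho {f : PowerSeries R} (hf : PowerSeries.coeff 0 f = 1) (N : ℕ) :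
    jacobiDet f (fun j : Fin N => N - 1 - (j : ℕ)) = 1 := by
  rw [jacobiDet, Matrix.det_of_isUpperTriangular]
  · refine Finset.prod_eq_one fun i _ => ?_
    rw [Matrix.of_apply, ← coeffInt_zero_of_coeff hf]
    congr 1
    omega
  · intro i j hij
    have hij : j < i := hij
    have hij : (j : ℕ) < i := hij
    exact coeffInt_of_neg f (by omega)

/-- An empty part contributes the last row f_{j-N}, which is (0, …, 0, 1). Hence the size of the
determinant is immaterial once it is at least the length. -/
theorem jacobiDet_addRho_succ {f : PowerSeries R} (hf : PowerSeries.coeff 0 f = 1) {N : ℕ}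
    {mu : YoungDiagram} (h : mu.colLen 0 ≤ N) :
    jacobiDet f (addRho (N + 1) mu) = jacobiDet f (addRho N mu) := by
  have h0 := (rowLen_eq_zero_iff mu N).2 h
  rw [jacobiDet, Matrix.det_succ_row _ (Fin.last N), Finset.sum_eq_single (Fin.last N)]
  · have h1 : coeffInt f ((addRho (N + 1) mu (Fin.last N) : ℤ) + (Fin.last N : ℕ) + 1 -
        (N + 1 : ℕ)) = 1 := by
      rw [← coeffInt_zero_of_coeff hf]
      congr 1
      simp [addRho, h0]
    rw [Matrix.of_apply, h1, Fin.val_last, ← two_mul, pow_mul, neg_one_sq, one_pow, one_mul,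
      one_mul, jacobiDet]
    congr 1
    ext i j
    simp only [Matrix.submatrix_apply, Fin.succAbove_last, Matrix.of_apply, addRho,
      Fin.val_castSucc]
    congr 1
    have := i.2
    omega
  · intro j _ hj
    have hj' : (j : ℕ) < N := by
      have h1 : (j : ℕ) ≠ N := fun h => hj (Fin.ext h)
      have := j.2
      omega
    rw [Matrix.of_apply, coeffInt_of_neg, mul_zero, zero_mul]
    simp only [addRho, Fin.val_last, h0]
    omega
  · simp

theorem jacobiDet_addRho_of_le {f : PowerSeries R} (hf : PowerSeries.coeff 0 f = 1) {N N' : ℕ}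
    {mu : YoungDiagram} (h : mu.colLen 0 ≤ N) (h' : N ≤ N') :
    jacobiDet f (addRho N' mu) = jacobiDet f (addRho N mu) := by
  induction N', h' using Nat.le_induction with
  | base => rfl
  | succ k hk ih => rw [jacobiDet_addRho_succ hf (h.trans hk), ih]

theorem prod_erase_mul_geomProd {n : ℕ} (x : Fin n → R) (l : Fin n) :
    (∏ i ∈ Finset.univ.erase l, (1 - PowerSeries.C (x i) * PowerSeries.X)) * geomProd x =
      PowerSeries.mk fun k => x l ^ k := by
  rw [geomProd, ← Finset.mul_prod_erase Finset.univ _ (Finset.mem_univ l), mul_left_comm,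
    ← Finset.prod_mul_distrib]
  simp [one_sub_mul_mk_pow]

/-- The power x_j^α is itself a value of a coefficient functional of ∏(1 - x_i z)⁻¹, namely on ∏_{i
≠ j}(u - x_i). So the alternant is `jacobiDet` times a determinant independent of α, which is
identified by taking α = ρ. -/
theorem det_pow_eq {n : ℕ} (x : Fin n → R) (α : Fin n → ℕ) :
    (Matrix.of fun i j : Fin n => x i ^ α j).det =
      jacobiDet (geomProd x) α *
        (Matrix.of fun i j : Fin n => x i ^ (n - 1 - (j : ℕ))).det := by
  nontriviality R
  let Q : Fin n → Polynomial R := fun l =>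
    ∏ i ∈ Finset.univ.erase l, (Polynomial.X - Polynomial.C (x i))
  have key : ∀ α : Fin n → ℕ, (Matrix.of fun i j : Fin n => x i ^ α j).det =
      jacobiDet (geomProd x) α * (Matrix.of fun b j : Fin n => (Q j).coeff b).det := by
    intro α
    have h := det_functionals (fun i => shiftFunctional (geomProd x) ((α i : ℤ) + 1 - n)) Q
      (fun j => by
        have := j.2
        rw [Polynomial.degree_eq_natDegree (Polynomial.monic_prod_X_sub_C x _).ne_zero,
          Polynomial.natDegree_finsetProd_X_sub_C_eq_card, Finset.card_erase_of_mem (Finset.mem_univ j), Finset.card_univ, Fintype.card_fin]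
        exact_mod_cast (by omega : n - 1 < n))
    rw [← Matrix.det_transpose]
    convert h using 2
    · ext i j
      -- The n - 1 factors of `Q j` raise the index from α_i + 1 - n to α_i and cancel every factor
      -- of the series except (1 - x_j z)⁻¹. The remaining polynomial 1 is written as X ^ 0.
      rw [Matrix.transpose_apply, Matrix.of_apply, Matrix.of_apply, ← mul_one (Q j),
        shiftFunctional_prod_mul, prod_erase_mul_geomProd, ← pow_zero Polynomial.X,
        shiftFunctional_X_pow, Finset.card_erase_of_mem (Finset.mem_univ j), Finset.card_univ,
        Fintype.card_fin]
      have := j.2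
      rw [show (α i : ℤ) + 1 - n + ((n - 1 : ℕ) : ℤ) + (0 : ℕ) = (α i : ℕ) by omega,
        coeffInt_natCast, PowerSeries.coeff_mk]
    · rw [jacobiDet]
      congr 1
      ext i j
      rw [Matrix.of_apply, Matrix.of_apply, shiftFunctional_X_pow]
      congr 1
      ring
  rw [key, key, jacobiDet_rho (constantCoeff_geomProd x), one_mul]

theorem schurPoly_eq_jacobiDet {n : ℕ} {mu : YoungDiagram} (h : mu.colLen 0 ≤ n) :
    schurPoly n mu = jacobiDet (geomProd MvPolynomial.X) (addRho n mu) := by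
  apply mul_left_cancel₀ (delta_X_ne_zero n)
  rw [delta_mul_schurPoly h, delta_eq_alternant, alternant, det_pow_eq, mul_comm, alternant]

theorem schur_snoc_zero (mu : YoungDiagram) {n : ℕ} (x : Fin n → R) :
    schur mu (Fin.snoc x 0 : Fin (n + 1) → R) = schur mu x := by
  have h : (MvPolynomial.aeval (Fin.snoc x 0 : Fin (n + 1) → R) :
      MvPolynomial (Fin (n + 1)) ℤ →ₐ[ℤ] R) = (MvPolynomial.aeval x).comp (dropLast n) := by
    apply MvPolynomial.algHom_ext
    intro i
    refine Fin.lastCases ?_ (fun i => ?_) i <;> simp [dropLast]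
  rw [schur, schur, h, AlgHom.comp_apply, dropLast_schurPoly]

theorem geomProd_snoc_zero {n : ℕ} (x : Fin n → R) :
    geomProd (Fin.snoc x 0 : Fin (n + 1) → R) = geomProd x := by
  rw [geomProd, Fin.prod_univ_castSucc, geomProd]
  have : (PowerSeries.mk fun k => (0 : R) ^ k) = 1 := by
    ext k
    simp [PowerSeries.coeff_one, zero_pow_eq]
  simp [this]

theorem schur_eq_jacobiDet_self {n : ℕ} {mu : YoungDiagram} (h : mu.colLen 0 ≤ n)
    (x : Fin n → R) : schur mu x = jacobiDet (geomProd x) (addRho n mu) := by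
  have h1 := map_jacobiDet (MvPolynomial.aeval x : MvPolynomial (Fin n) ℤ →ₐ[ℤ] R).toRingHom
    (geomProd MvPolynomial.X) (addRho n mu)
  rw [← schurPoly_eq_jacobiDet h, map_geomProd] at h1
  rw [schur]
  simpa using h1

/-- The Jacobi-Trudi identity. -/
theorem schur_eq_jacobiDet {N n : ℕ} {mu : YoungDiagram} (h : mu.colLen 0 ≤ N) (x : Fin n → R) :
    schur mu x = jacobiDet (geomProd x) (addRho N mu) := by
  rcases le_total N n with hN | hN
  · rw [← jacobiDet_addRho_of_le (constantCoeff_geomProd x) h hN,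
      schur_eq_jacobiDet_self (h.trans hN)]
  -- With fewer variables than rows, zeros are appended to the variables; neither side notices them.
  · obtain ⟨d, hd⟩ := Nat.exists_eq_add_of_le hN
    clear hN
    induction d generalizing n with
    | zero =>
      subst hd
      exact schur_eq_jacobiDet_self h x
    | succ d ih => rw [← schur_snoc_zero, ih _ (by omega), geomProd_snoc_zero]

end JacobiTrudi

/-! ### The dual Jacobi-Trudi identity -/

section DualJacobiTrudi

variable {R : Type*} [CommRing R]

theorem coeffInt_one (k : ℤ) : coeffInt (1 : PowerSeries R) k = if k = 0 then 1 else 0 := by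
  rw [coeffInt]
  split_ifs with h1 h2 h2
  · simp [h2]
  · rw [PowerSeries.coeff_one, if_neg (by omega)]
  · omega
  · rfl

/-- The coefficient is the functional of the series 1 with shift k - m > 0 applied to `rootPoly w`,
and it only meets coefficients of 1 at positive indices. -/
theorem coeffInt_oneSubProd_of_lt {m : ℕ} (w : Fin m → R) {k : ℤ} (h : m < k) :
    coeffInt (oneSubProd w) k = 0 := by
  have h1 := shiftFunctional_rootPoly_mul w 1 (k - m) (Polynomial.X ^ 0)
  rw [shiftFunctional_X_pow, mul_one, Fintype.card_fin,
    show k - m + m + ((0 : ℕ) : ℤ) = k by push_cast; ring] at h1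
  rw [← h1, shiftFunctional, Polynomial.lsum_apply, Polynomial.sum_def]
  refine Finset.sum_eq_zero fun b _ => ?_
  rw [coeffInt_one, if_neg (by omega)]
  simp

theorem mem_iff_lt_rowLen_transpose (nu : YoungDiagram) (i j : ℕ) :
    j < nu.rowLen i ↔ i < nu.transpose.rowLen j := by
  rw [← YoungDiagram.mem_iff_lt_rowLen, YoungDiagram.rowLen_transpose,
    YoungDiagram.mem_iff_lt_colLen]

/-- The permutation of `0, …, m + N - 1` that consists of `nu' + ρ_m` and the complementary
sequence. -/
def conjFun (m N : ℕ) (nu : YoungDiagram) : Fin m ⊕ Fin N → ℕ :=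
  Sum.elim (addRho m nu.transpose) fun i => m + i - nu.rowLen i

/-- Both comparisons ask on which side of the boundary of the diagram the cell (i, j) lies. That the
values never agree makes the two sequences complementary. -/
theorem conjFun_inl_lt_inr {m N : ℕ} {nu : YoungDiagram} (hm : nu.rowLen 0 ≤ m)
    (j : Fin m) (i : Fin N) :
    (conjFun m N nu (Sum.inl j) < conjFun m N nu (Sum.inr i) ↔ nu.transpose.rowLen j ≤ i) ∧
      conjFun m N nu (Sum.inl j) ≠ conjFun m N nu (Sum.inr i) := by
  have h1 := mem_iff_lt_rowLen_transpose nu i j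
  have h2 := (nu.rowLen_anti 0 i (Nat.zero_le _)).trans hm
  have h3 := j.2
  simp only [conjFun, Sum.elim_inl, Sum.elim_inr, addRho]
  by_cases h : (j : ℕ) < nu.rowLen i
  · have := h1.1 h
    omega
  · have := mt h1.2 h
    omega

theorem conjFun_inr_strictMono {m N : ℕ} {nu : YoungDiagram} (hm : nu.rowLen 0 ≤ m) :
    StrictMono fun i : Fin N => conjFun m N nu (Sum.inr i) := by
  intro i i' h
  have h0 : (i : ℕ) < i' := h
  have h1 := nu.rowLen_anti i i' h0.le
  have h2 := (nu.rowLen_anti 0 i (Nat.zero_le _)).trans hm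
  simp only [conjFun, Sum.elim_inr]
  omega

theorem conjFun_lt {m N : ℕ} {nu : YoungDiagram} (hN : nu.colLen 0 ≤ N) (hm : nu.rowLen 0 ≤ m)
    (i : Fin m ⊕ Fin N) : conjFun m N nu i < m + N := by
  rcases i with j | i
  · have := j.2
    have h1 : nu.transpose.rowLen j ≤ N := by
      rw [YoungDiagram.rowLen_transpose]
      exact (nu.colLen_anti 0 j (Nat.zero_le _)).trans hN
    simp only [conjFun, Sum.elim_inl, addRho]
    omega
  · have := i.2
    simp only [conjFun, Sum.elim_inr]
    omega

theorem conjFun_injective {m N : ℕ} {nu : YoungDiagram} (hm : nu.rowLen 0 ≤ m) :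
    Function.Injective (conjFun m N nu) := by
  rintro (j | i) (j' | i') h
  · exact congrArg _ ((strictAnti_addRho m nu.transpose).injective h)
  · exact absurd h (conjFun_inl_lt_inr hm j i').2
  · exact absurd h.symm (conjFun_inl_lt_inr hm j' i).2
  · exact congrArg _ ((conjFun_inr_strictMono hm).injective h)

/-- `conjFun` as a bijection. -/
noncomputable def conjEquiv {m N : ℕ} {nu : YoungDiagram} (hN : nu.colLen 0 ≤ N)
    (hm : nu.rowLen 0 ≤ m) : Fin m ⊕ Fin N ≃ Fin (m + N) :=
  Equiv.ofBijective (fun i => ⟨conjFun m N nu i, conjFun_lt hN hm i⟩)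
    ((Fintype.bijective_iff_injective_and_card _).2
      ⟨fun _ _ h => conjFun_injective hm (Fin.ext_iff.1 h), by simp⟩)

theorem coe_conjEquiv {m N : ℕ} {nu : YoungDiagram} (hN : nu.colLen 0 ≤ N)
    (hm : nu.rowLen 0 ≤ m) (i : Fin m ⊕ Fin N) : (conjEquiv hN hm i : ℕ) = conjFun m N nu i :=
  rfl

/-- Inversions are counted by their first member. The j-th entry of ν' + ρ_m exceeds the m - 1 - j
later ones of its own block and exactly ν'_j of the complementary block; the latter is increasing
and adds none. The exponents are those of the alternant, so the sign will cancel the signs of the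
powers of -X_i. -/
theorem sign_conjEquiv {m N : ℕ} {nu : YoungDiagram} (hN : nu.colLen 0 ≤ N)
    (hm : nu.rowLen 0 ≤ m) :
    Equiv.Perm.sign (finSumFinEquiv.symm.trans (conjEquiv hN hm)) =
      ∏ j : Fin m, (-1) ^ addRho m nu.transpose j := by
  have h0 : ∀ (n : ℕ) (f : Fin n → Fin n → ℤˣ), ∏ i, ∏ j ∈ Finset.Ioi i, f i j =
      ∏ i, ∏ j, if i < j then f i j else 1 := fun n f => by
    refine Finset.prod_congr rfl fun i _ => ?_
    rw [← Finset.prod_filter]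
    refine Finset.prod_congr ?_ fun _ _ => rfl
    ext
    simp
  rw [Equiv.Perm.sign_eq_prod_prod_Ioi, h0, Fin.prod_univ_add]
  have h1 : ∀ i : Fin N, ∏ j, (if Fin.natAdd m i < j then
      (if (finSumFinEquiv.symm.trans (conjEquiv hN hm)) (Fin.natAdd m i) <
        (finSumFinEquiv.symm.trans (conjEquiv hN hm)) j then (1 : ℤˣ) else -1) else 1) = 1 := by
    intro i
    refine Finset.prod_eq_one fun j _ => ?_
    refine Fin.addCases (fun j => ?_) (fun j => ?_) j
    · rw [if_neg]
      have := j.2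
      rw [Fin.lt_def]
      simp
      omega
    · split_ifs with h h'
      · rfl
      · refine absurd ?_ h'
        rw [Fin.lt_def]
        simp only [Equiv.trans_apply, finSumFinEquiv_symm_apply_natAdd, coe_conjEquiv]
        exact conjFun_inr_strictMono hm (by simpa using h)
      · rfl
  rw [Finset.prod_congr rfl fun i _ => h1 i, Finset.prod_const_one, mul_one]
  refine Finset.prod_congr rfl fun j _ => ?_
  rw [Fin.prod_univ_add, addRho, pow_add, mul_comm]
  congr 1
  · have h2 : ∀ i : Fin N, (if Fin.castAdd N j < Fin.natAdd m i then
        (if (finSumFinEquiv.symm.trans (conjEquiv hN hm)) (Fin.castAdd N j) <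
        (finSumFinEquiv.symm.trans (conjEquiv hN hm)) (Fin.natAdd m i) then (1 : ℤˣ) else -1)
        else 1) = if (i : ℕ) < nu.transpose.rowLen j then -1 else 1 := by
      intro i
      have h3 := (conjFun_inl_lt_inr hm j i).1
      rw [if_pos (by rw [Fin.lt_def]; have := j.2; simp; omega)]
      simp only [Equiv.trans_apply, finSumFinEquiv_symm_apply_natAdd,
        finSumFinEquiv_symm_apply_castAdd, Fin.lt_def, coe_conjEquiv]
      by_cases h : (i : ℕ) < nu.transpose.rowLen j
      · rw [if_neg (by omega), if_pos h]
      · rw [if_pos (by omega), if_neg h]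
    have h4 : nu.transpose.rowLen j ≤ N := by
      rw [YoungDiagram.rowLen_transpose]
      exact (nu.colLen_anti 0 j (Nat.zero_le _)).trans hN
    rw [Finset.prod_congr rfl fun i _ => h2 i, ← Finset.prod_filter, Finset.prod_const,
      Fin.card_filter_val_lt, min_eq_right h4]
  · rw [← Fin.card_Ioi, ← Finset.prod_const, ← Finset.filter_lt_eq_Ioi, Finset.prod_filter]
    refine Finset.prod_congr rfl fun k _ => ?_
    simp only [Equiv.trans_apply, finSumFinEquiv_symm_apply_castAdd, Fin.lt_def, coe_conjEquiv,
      Fin.val_castAdd]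
    split_ifs with h h'
    · exact absurd h' (strictAnti_addRho m nu.transpose h).not_gt
    · rfl
    · rfl

/-- The dual Jacobi-Trudi identity. -/
theorem schur_transpose_eq_jacobiDet {N m : ℕ} {nu : YoungDiagram} (h : nu.colLen 0 ≤ N)
    (y : Fin m → R) :
    schur nu.transpose y = jacobiDet (oneSubProd (-y)) (addRho N nu) := by
  by_cases hm : nu.rowLen 0 ≤ m
  · suffices hu : schurPoly m nu.transpose =
        jacobiDet (oneSubProd (-MvPolynomial.X)) (addRho N nu) by
      have h1 := map_jacobiDet (MvPolynomial.aeval y : MvPolynomial (Fin m) ℤ →ₐ[ℤ] R).toRingHom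
        (oneSubProd (-MvPolynomial.X)) (addRho N nu)
      rw [← hu, map_oneSubProd] at h1
      rw [schur]
      simpa using! h1
    have hc : nu.transpose.colLen 0 ≤ m := by rwa [YoungDiagram.colLen_transpose]
    apply mul_left_cancel₀ (delta_X_ne_zero m)
    rw [delta_mul_schurPoly hc]
    have hd : (Matrix.vandermonde (-MvPolynomial.X : Fin m → MvPolynomial (Fin m) ℤ)).det =
        delta MvPolynomial.X := by
      rw [Matrix.det_vandermonde, delta]
      refine Finset.prod_congr rfl fun i _ => Finset.prod_congr rfl fun j _ => ?_
      simp only [Pi.neg_apply]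
      ring
    -- With the series 1, the coefficient rows are unit vectors, whose nonzero entries stand in the
    -- columns m + i - ν_i. The complementary columns carry the alternant of ν' + ρ_m in the
    -- variables -X.
    have h1 := det_mixedFunctional 1 (-MvPolynomial.X : Fin m → MvPolynomial (Fin m) ℤ)
      (addRho N nu)
    rw [hd, mul_one] at h1
    rw [← h1]
    set Z := Matrix.of fun i b : Fin (m + N) => mixedFunctional (m + N) 1
      (-MvPolynomial.X : Fin m → MvPolynomial (Fin m) ℤ) (addRho N nu) (finSumFinEquiv.symm i)
      (Polynomial.X ^ (b : ℕ)) with hZ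
    have h2 := Matrix.det_permute' (finSumFinEquiv.symm.trans (conjEquiv h hm)) Z
    -- Sorting the columns by `conjEquiv` makes the matrix block triangular with an identity block.
    rw [sign_conjEquiv, ← Matrix.det_submatrix_equiv_self finSumFinEquiv] at h2
    have hb : (Z.submatrix id (finSumFinEquiv.symm.trans (conjEquiv h hm))).submatrix
        finSumFinEquiv finSumFinEquiv = Matrix.fromBlocks
        (Matrix.of fun i j => (-1) ^ addRho m nu.transpose j *
          (Matrix.of fun i j : Fin m => (MvPolynomial.X i : MvPolynomial (Fin m) ℤ) ^
            addRho m nu.transpose j) i j)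
        (Matrix.of fun i j => (-MvPolynomial.X i) ^ conjFun m N nu (Sum.inr j)) 0 1 := by
      have hs : ∀ (i : Fin N) (j : Fin m ⊕ Fin N), (addRho N nu i : ℤ) + 1 - (m + N : ℕ) +
          (conjFun m N nu j : ℕ) =
          (conjFun m N nu j : ℤ) - (conjFun m N nu (Sum.inr i) : ℤ) := by
        intro i j
        have h3 := nu.rowLen_anti 0 i (Nat.zero_le _)
        have := i.2
        have h4 : conjFun m N nu (Sum.inr i) = m + i - nu.rowLen i := rfl
        rw [h4, addRho]
        omega
      refine Matrix.ext fun i j => ?_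
      rcases i with i | i <;> rcases j with j | j
      · simp [hZ, mixedFunctional, coe_conjEquiv, conjFun, neg_pow (MvPolynomial.X i : MvPolynomial (Fin m) ℤ)]
      · simp [hZ, mixedFunctional, coe_conjEquiv]
      · simp only [Matrix.submatrix_apply, hZ, mixedFunctional, Matrix.of_apply, id,
          Equiv.symm_apply_apply, Sum.elim_inr, shiftFunctional_X_pow, coe_conjEquiv,
          Equiv.trans_apply]
        rw [hs, coeffInt_one, if_neg]
        · rfl
        · have := (conjFun_inl_lt_inr hm j i).2
          omega
      · simp only [Matrix.submatrix_apply, hZ, mixedFunctional, Matrix.of_apply, id,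
          Equiv.symm_apply_apply, Sum.elim_inr, shiftFunctional_X_pow, coe_conjEquiv,
          Equiv.trans_apply]
        rw [hs, coeffInt_one, Matrix.fromBlocks_apply₂₂, Matrix.one_apply]
        by_cases hij : i = j
        · simp [hij]
        · have := (conjFun_inr_strictMono hm).injective.ne hij
          rw [if_neg hij, if_neg]
          omega
    rw [hb, Matrix.det_fromBlocks_zero₂₁, Matrix.det_one, mul_one, Matrix.det_mul_row] at h2
    have h3 : ((∏ j : Fin m, (-1 : ℤˣ) ^ addRho m nu.transpose j : ℤˣ) : ℤ) =
        ∏ j : Fin m, (-1) ^ addRho m nu.transpose j := by simp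
    rw [h3] at h2
    push_cast at h2
    apply mul_left_cancel₀ _ h2
    refine Finset.prod_ne_zero_iff.2 fun j _ => pow_ne_zero _ (by simp)
  -- If ν_1 > m, both sides vanish: ν' has more than m rows, and the first row of the determinant
  -- consists of coefficients of index above m of a polynomial of degree at most m.
  · rw [schur, schurPoly_of_lt, map_zero, jacobiDet]
    · have hN : 0 < N := by
        rcases Nat.eq_zero_or_pos N with rfl | hN
        · have := (rowLen_eq_zero_iff nu 0).2 h
          omega
        · exact hN
      symm
      apply Matrix.det_eq_zero_of_row_eq_zero ⟨0, hN⟩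
      intro j
      rw [Matrix.of_apply]
      apply coeffInt_oneSubProd_of_lt
      simp only [addRho]
      omega
    · rw [YoungDiagram.colLen_transpose]
      omega

end DualJacobiTrudi

/-! ### Cauchy expansions and the Jacobi-Trudi identity for Littlewood-Schur functions -/

section Cauchy

variable {R : Type*} [CommRing R]

theorem IsAlternating.coeff_comp {n : ℕ} {P : MvPolynomial (Fin n) ℤ} (hP : IsAlternating P)
    (σ : Equiv.Perm (Fin n)) (β : Fin n → ℕ) :
    MvPolynomial.coeff (toExp (β ∘ σ)) P =
      ((Equiv.Perm.sign σ : ℤˣ) : ℤ) * MvPolynomial.coeff (toExp β) P := by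
  have h1 := MvPolynomial.coeff_rename_mapDomain σ σ.injective P (toExp (β ∘ σ))
  rw [hP σ, MvPolynomial.coeff_C_mul] at h1
  rw [← h1]
  congr 2
  ext i
  rw [← Finsupp.equivMapDomain_eq_mapDomain, Finsupp.equivMapDomain_apply, toExp_apply,
    toExp_apply, Function.comp_apply, Equiv.apply_symm_apply]

theorem IsAlternating.coeff_eq_zero {n : ℕ} {P : MvPolynomial (Fin n) ℤ} (hP : IsAlternating P)
    {β : Fin n → ℕ} (hβ : ¬Function.Injective β) : MvPolynomial.coeff (toExp β) P = 0 := by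
  simp only [Function.Injective, not_forall] at hβ
  obtain ⟨i, j, hij, hne⟩ := hβ
  have h1 := hP.coeff_comp (Equiv.swap i j) β
  have h2 : β ∘ Equiv.swap i j = β := by
    ext k
    rw [Function.comp_apply, Equiv.swap_apply_def]
    split_ifs with ha hb
    · rw [ha, hij]
    · rw [hb, hij]
    · rfl
  rw [h2, Equiv.Perm.sign_swap hne] at h1
  simp at h1
  omega

theorem exists_strictAnti_comp {n : ℕ} {β : Fin n → ℕ} (hβ : Function.Injective β) :
    ∃ σ : Equiv.Perm (Fin n), StrictAnti (β ∘ σ) := by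
  let f : Fin n → ℕᵒᵈ := fun i => OrderDual.toDual (β i)
  have hm : StrictMono (f ∘ Tuple.sort f) := (Tuple.monotone_sort f).strictMono_of_injective
    (Function.Injective.comp (fun i j hij => hβ hij) (Tuple.sort f).injective)
  exact ⟨Tuple.sort f, fun i j hij => hm hij⟩

theorem jacobiDet_comp (f : PowerSeries R) {N : ℕ} (σ : Equiv.Perm (Fin N)) (α : Fin N → ℕ) :
    jacobiDet f (α ∘ σ) = ((Equiv.Perm.sign σ : ℤˣ) : ℤ) * jacobiDet f α :=
  Matrix.det_permute σ (Matrix.of fun i j : Fin N => coeffInt f ((α i : ℤ) + j + 1 - N))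

theorem jacobiDet_eq_zero (f : PowerSeries R) {N : ℕ} {α : Fin N → ℕ}
    (hα : ¬Function.Injective α) : jacobiDet f α = 0 := by
  simp only [Function.Injective, not_forall] at hα
  obtain ⟨i, j, hij, hne⟩ := hα
  apply Matrix.det_zero_of_row_eq hne
  ext k
  simp [hij]

/-- The power series `∏ i, f (z_i)`. -/
noncomputable def prodSeries (N : ℕ) (f : PowerSeries R) : MvPowerSeries (Fin N) R :=
  fun γ => ∏ i, PowerSeries.coeff (γ i) f

theorem coeff_prodSeries {N : ℕ} (f : PowerSeries R) (γ : Fin N →₀ ℕ) :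
    MvPowerSeries.coeff γ (prodSeries N f) = ∏ i, PowerSeries.coeff (γ i) f :=
  rfl

theorem prodSeries_mul (N : ℕ) (f g : PowerSeries R) :
    prodSeries N f * prodSeries N g = prodSeries N (f * g) := by
  classical
  ext γ
  rw [MvPowerSeries.coeff_mul, coeff_prodSeries]
  simp only [PowerSeries.coeff_mul, coeff_prodSeries]
  rw [Finset.prod_univ_sum]
  simp only [← Finset.prod_mul_distrib]
  refine Finset.sum_nbij' (fun p i => (p.1 i, p.2 i))
    (fun q => (toExp fun i => (q i).1, toExp fun i => (q i).2)) ?_ ?_ ?_ ?_ ?_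
  · intro p hp
    rw [Finset.HasAntidiagonal.mem_antidiagonal] at hp
    simp [Fintype.mem_piFinset, ← hp]
  · intro q hq
    simp only [Fintype.mem_piFinset, Finset.HasAntidiagonal.mem_antidiagonal] at hq ⊢
    ext i
    exact hq i
  · intro p _
    refine Prod.ext ?_ ?_ <;> exact Finsupp.ext fun i => rfl
  · intro q _
    rfl
  · intro p _
    rfl

/-- Integral polynomials as power series over `R`. -/
noncomputable def toSeries (N : ℕ) (R : Type*) [CommRing R] :
    MvPolynomial (Fin N) ℤ →+* MvPowerSeries (Fin N) R :=
  MvPolynomial.coeToMvPowerSeries.ringHom.comp (MvPolynomial.map (Int.castRingHom R))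

theorem coeff_toSeries {N : ℕ} (P : MvPolynomial (Fin N) ℤ) (d : Fin N →₀ ℕ) :
    MvPowerSeries.coeff d (toSeries N R P) = ((MvPolynomial.coeff d P : ℤ) : R) := by
  simp [toSeries, MvPolynomial.coeff_map]

theorem toSeries_monomial {N : ℕ} (d : Fin N →₀ ℕ) (a : ℤ) :
    toSeries N R (MvPolynomial.monomial d a) = MvPowerSeries.monomial d (a : R) := by
  simp [toSeries, MvPolynomial.map_monomial]

/-- Expanding Δ as an alternant turns the coefficient into the Leibniz formula: the term of σ picks
f at δ_i - (N - 1 - σ⁻¹(i)) for each i. -/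
theorem coeff_delta_mul_prodSeries {N : ℕ} (f : PowerSeries R) (δ : Fin N → ℕ) :
    MvPowerSeries.coeff (toExp δ) (toSeries N R (delta MvPolynomial.X) * prodSeries N f) =
      jacobiDet f δ := by
  classical
  rw [delta_eq_alternant, alternant_eq_sum, map_sum, Finset.sum_mul, map_sum, jacobiDet,
    Matrix.det_apply']
  refine Finset.sum_congr rfl fun σ _ => ?_
  rw [toSeries_monomial, MvPowerSeries.coeff_monomial_mul, ← Equiv.prod_comp σ.symm]
  simp only [Equiv.apply_symm_apply, Matrix.of_apply]
  split_ifs with h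
  · congr 1
    rw [coeff_prodSeries]
    refine Finset.prod_congr rfl fun i _ => ?_
    have h1 : N - 1 - (σ.symm i : ℕ) ≤ δ i := h i
    have h2 : (toExp δ - toExp ((fun j : Fin N => N - 1 - (j : ℕ)) ∘ σ.symm)) i =
        δ i - (N - 1 - (σ.symm i : ℕ)) := rfl
    rw [h2, ← coeffInt_natCast]
    congr 1
    omega
  -- A negative exponent: the monomial does not divide, and `coeffInt` is zero there as well.
  · symm
    obtain ⟨i, hi⟩ : ∃ i, ¬ N - 1 - (σ.symm i : ℕ) ≤ δ i := by
      by_contra! hc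
      exact h fun i => hc i
    rw [Finset.prod_eq_zero (Finset.mem_univ i), mul_zero]
    exact coeffInt_of_neg _ (by omega)

/-- This is the Cauchy expansion Δ(z)∏ f(z_i) = ∑_μ c_μ Δ(z) s_μ(z), read off at z^δ. Both sides
alternate in δ, so δ may be sorted into some ν + ρ_N, where only μ = ν contributes. The abstract `c`
allows for s_μ(x) as well as s_{μ'}(y). -/
theorem jacobiDet_eq_sum (f : PowerSeries R) {N : ℕ} (δ : Fin N → ℕ) {c : YoungDiagram → R}
    (hc : ∀ mu : YoungDiagram, mu.colLen 0 ≤ N → c mu = jacobiDet f (addRho N mu))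
    {s : Finset YoungDiagram} (hs : ∀ mu : YoungDiagram, mu.card ≤ ∑ i, δ i → mu ∈ s) :
    jacobiDet f δ = ∑ mu ∈ s, c mu *
      ((MvPolynomial.coeff (toExp δ) (delta MvPolynomial.X * schurPoly N mu) : ℤ) : R) := by
  classical
  by_cases hδ : Function.Injective δ
  · obtain ⟨τ, hτ⟩ := exists_strictAnti_comp hδ
    obtain ⟨nu, hnu, hν⟩ := exists_addRho_eq hτ
    have hδ' : δ = addRho N nu ∘ τ.symm := by
      rw [hν]
      ext i
      simp
    have hmem : nu ∈ s := by
      apply hs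
      have h1 : ∑ i, δ i = ∑ i, addRho N nu i := by
        rw [← Equiv.sum_comp τ δ, hν]
        rfl
      rw [h1, sum_addRho hnu]
      omega
    rw [Finset.sum_eq_single_of_mem nu hmem, hc nu hnu, delta_mul_schurPoly hnu, hδ',
      (isAlternating_alternant _).coeff_comp,
      coeff_alternant (strictAnti_addRho _ _) (strictAnti_addRho _ _), if_pos rfl, jacobiDet_comp]
    · push_cast
      ring
    · intro mu _ hne
      by_cases h : mu.colLen 0 ≤ N
      · rw [delta_mul_schurPoly h, hδ', (isAlternating_alternant _).coeff_comp,
          coeff_alternant (strictAnti_addRho _ _) (strictAnti_addRho _ _),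
          if_neg fun he => hne (addRho_injective h hnu he)]
        simp
      · rw [schurPoly_of_lt (not_le.1 h)]
        simp
  · rw [jacobiDet_eq_zero f hδ, Finset.sum_eq_zero]
    intro mu _
    by_cases h : mu.colLen 0 ≤ N
    · rw [delta_mul_schurPoly h, (isAlternating_alternant _).coeff_eq_zero hδ]
      simp
    · rw [schurPoly_of_lt (not_le.1 h)]
      simp

theorem coeff_mul_congr {σ : Type*} {P P' Q : MvPowerSeries σ R} {d : σ →₀ ℕ}
    (h : ∀ e ≤ d, MvPowerSeries.coeff e P = MvPowerSeries.coeff e P') :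
    MvPowerSeries.coeff d (P * Q) = MvPowerSeries.coeff d (P' * Q) := by
  classical
  rw [MvPowerSeries.coeff_mul, MvPowerSeries.coeff_mul]
  refine Finset.sum_congr rfl fun p hp => ?_
  rw [h p.1 (le_iff_exists_add.2 ⟨p.2, (Finset.HasAntidiagonal.mem_antidiagonal.1 hp).symm⟩)]

/-- A coefficient of a product at α only sees coefficients at exponents below α, so the infinite
Cauchy expansion may be cut down to the finite set `s` even in the presence of a further factor. -/
theorem coeff_delta_mul_prodSeries_mul (f : PowerSeries R) {N : ℕ} (α : Fin N → ℕ)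
    {c : YoungDiagram → R}
    (hc : ∀ mu : YoungDiagram, mu.colLen 0 ≤ N → c mu = jacobiDet f (addRho N mu))
    {s : Finset YoungDiagram} (hs : ∀ mu : YoungDiagram, mu.card ≤ ∑ i, α i → mu ∈ s)
    (Q : MvPowerSeries (Fin N) R) :
    MvPowerSeries.coeff (toExp α) (toSeries N R (delta MvPolynomial.X) * prodSeries N f * Q) =
      ∑ mu ∈ s, c mu * MvPowerSeries.coeff (toExp α)
        (toSeries N R (delta MvPolynomial.X * schurPoly N mu) * Q) := by
  have h := coeff_mul_congr (P := toSeries N R (delta MvPolynomial.X) * prodSeries N f)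
    (P' := ∑ mu ∈ s, c mu • toSeries N R (delta MvPolynomial.X * schurPoly N mu)) (Q := Q)
    (d := toExp α) ?_
  · rw [h, Finset.sum_mul, map_sum]
    simp
  · intro e he
    obtain ⟨δ, rfl⟩ : ∃ δ, toExp δ = e := ⟨e, by ext; rfl⟩
    rw [coeff_delta_mul_prodSeries, jacobiDet_eq_sum f δ hc (s := s), map_sum]
    · simp [coeff_toSeries, -map_mul]
    · exact fun mu hmu => hs mu (hmu.trans (Finset.sum_le_sum fun i _ => he i))

/-- The Jacobi-Trudi identity for Littlewood-Schur functions. -/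
theorem LS_eq_jacobiDet {N : ℕ} {lam : YoungDiagram} (h : lam.colLen 0 ≤ N) {a b : ℕ}
    (x : Fin a → R) (y : Fin b → R) :
    LS lam x y = jacobiDet (oneSubProd (-y) * geomProd x) (addRho N lam) := by
  classical
  set s := (finite_card_le (∑ i, addRho N lam i)).toFinset with hs
  have hs' : ∀ mu : YoungDiagram, mu.card ≤ ∑ i, addRho N lam i → mu ∈ s := by
    intro mu hmu
    simpa [hs] using hmu
  have hcard : lam.card ≤ ∑ i, addRho N lam i := by
    rw [sum_addRho h]
    omega
  -- The determinant is the coefficient of z^{λ+ρ} in Δ(z) times two product series, one for x and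
  -- one for y. Expanding each by Cauchy leaves the coefficients of Δ s_μ s_ν at λ + ρ, which are
  -- the Littlewood-Richardson coefficients.
  rw [LS, finsum_eq_sum_of_support_subset (s := s ×ˢ s), mul_comm, ← coeff_delta_mul_prodSeries,
    ← prodSeries_mul, ← mul_assoc,
    coeff_delta_mul_prodSeries_mul _ _ (fun mu hmu => schur_eq_jacobiDet hmu x) hs',
    Finset.sum_product]
  · refine Finset.sum_congr rfl fun mu _ => ?_
    have h1 : toSeries N R (delta MvPolynomial.X * schurPoly N mu) * prodSeries N (oneSubProd (-y))
        = toSeries N R (delta MvPolynomial.X) * prodSeries N (oneSubProd (-y)) *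
          toSeries N R (schurPoly N mu) := by
      rw [map_mul]
      ring
    rw [h1, coeff_delta_mul_prodSeries_mul _ _ (fun nu hnu => schur_transpose_eq_jacobiDet hnu y)
      hs', Finset.mul_sum]
    refine Finset.sum_congr rfl fun nu _ => ?_
    rw [← map_mul, coeff_toSeries, lrCoeff_eq_coeffIn h, coeffIn,
      mul_right_comm (delta MvPolynomial.X) (schurPoly N mu)]
    ring
  · rintro ⟨mu, nu⟩ hq
    have h1 : lrCoeff lam mu nu ≠ 0 := by
      rintro h0
      simp [h0] at hq
    have h2 := card_eq_of_lrCoeff_ne_zero h1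
    rw [Finset.mem_coe, Finset.mem_product]
    exact ⟨hs' _ (by dsimp only; omega), hs' _ (by dsimp only; omega)⟩

end Cauchy

/-! ### The Sylvester determinant and Laplace expansion along two blocks of columns -/

section Laplace

variable {R : Type*} [CommRing R]

/-- The matrix is the Sylvester matrix of s(u) and t(u), with t(u) treated as having degree M ≥ n.
As s(u) is monic of exact degree l, the padding does no harm, and the resultant is ∏ t(s_i). -/
theorem det_coeff_rootPoly [Nontrivial R] {l n M : ℕ} (h : n ≤ M) (s : Fin l → R)
    (t : Fin n → R) :
    (Matrix.of fun b j : Fin (l + M) => (Fin.addCases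
      (fun j : Fin l => rootPoly t * Polynomial.X ^ (j : ℕ))
      (fun j : Fin M => rootPoly s * Polynomial.X ^ (j : ℕ)) j : Polynomial R).coeff b).det =
      deltaPair s t := by
  have ht : (rootPoly t).natDegree ≤ M := by simpa [natDegree_rootPoly] using h
  have hs : (rootPoly s).natDegree = l := by simp [natDegree_rootPoly]
  have h1 : Polynomial.resultant (rootPoly s) (rootPoly t) l M = deltaPair s t := by
    have h2 := Polynomial.resultant_prod_left Finset.univ
      (fun i => Polynomial.X - Polynomial.C (s i)) (rootPoly t) M (by simp) ht
    rw [← rootPoly, hs] at h2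
    rw [h2, deltaPair]
    refine Finset.prod_congr rfl fun i _ => ?_
    rw [Polynomial.natDegree_X_sub_C, Polynomial.resultant_X_sub_C_left _ _ _ ht, eval_rootPoly]
  rw [← h1, Polynomial.resultant]
  congr 1
  ext b j
  refine Fin.addCases (fun j => ?_) (fun j => ?_) j
  · rw [Matrix.of_apply, Fin.addCases_left, Polynomial.sylvester, Matrix.of_apply,
      Fin.addCases_left, Polynomial.coeff_mul_X_pow']
    by_cases hb : (b : ℕ) ≤ j + M
    · simp [hb]
    · rw [if_pos (by omega), if_neg (by simp; omega), Polynomial.coeff_eq_zero_of_natDegree_lt]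
      omega
  · rw [Matrix.of_apply, Fin.addCases_right, Polynomial.sylvester, Matrix.of_apply,
      Fin.addCases_right, Polynomial.coeff_mul_X_pow']
    by_cases hb : (b : ℕ) ≤ j + l
    · simp [hb]
    · rw [if_pos (by omega), if_neg (by simp; omega), Polynomial.coeff_eq_zero_of_natDegree_lt]
      omega

variable {ι κ₁ κ₂ : Type*} [DecidableEq ι]

/-- The rows in `A` are replaced by zero on the second block of columns, the others on the
first. -/
def splitRows (Z : Matrix ι (κ₁ ⊕ κ₂) R) (A : Finset ι) : Matrix ι (κ₁ ⊕ κ₂) R :=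
  A.piecewise (fun i => Sum.elim (fun j => Z i (Sum.inl j)) 0)
    (fun i => Sum.elim 0 fun j => Z i (Sum.inr j))

theorem splitRows_inl_of_mem (Z : Matrix ι (κ₁ ⊕ κ₂) R) {A : Finset ι} {i : ι} (hi : i ∈ A)
    (j : κ₁) : splitRows Z A i (Sum.inl j) = Z i (Sum.inl j) := by
  simp [splitRows, hi]

theorem splitRows_inr_of_mem (Z : Matrix ι (κ₁ ⊕ κ₂) R) {A : Finset ι} {i : ι} (hi : i ∈ A)
    (j : κ₂) : splitRows Z A i (Sum.inr j) = 0 := by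
  simp [splitRows, hi]

theorem splitRows_inl_of_notMem (Z : Matrix ι (κ₁ ⊕ κ₂) R) {A : Finset ι} {i : ι} (hi : i ∉ A)
    (j : κ₁) : splitRows Z A i (Sum.inl j) = 0 := by
  simp [splitRows, hi]

theorem splitRows_inr_of_notMem (Z : Matrix ι (κ₁ ⊕ κ₂) R) {A : Finset ι} {i : ι} (hi : i ∉ A)
    (j : κ₂) : splitRows Z A i (Sum.inr j) = Z i (Sum.inr j) := by
  simp [splitRows, hi]

variable [Fintype κ₁] [DecidableEq κ₁] [Fintype κ₂] [DecidableEq κ₂]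

/-- Each row is the sum of its restrictions to the two blocks of columns; multilinearity in the rows
gives one term per choice. The row labels `ι` are kept apart from the column labels, with `φ` fixing
the order. -/
theorem det_eq_sum_splitRows [Fintype ι] (Z : Matrix ι (κ₁ ⊕ κ₂) R) (φ : κ₁ ⊕ κ₂ ≃ ι) :
    (Z.submatrix φ id).det = ∑ A : Finset ι, ((splitRows Z A).submatrix φ id).det := by
  have h := ((Matrix.detRowAlternating (R := R) (n := κ₁ ⊕ κ₂)).domDomCongr
    φ).toMultilinearMap.map_add_univ
      (fun i => Sum.elim (fun j => Z i (Sum.inl j)) 0) (fun i => Sum.elim 0 fun j => Z i (Sum.inr j))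
  refine Eq.trans ?_ h
  refine congrArg (fun W : Matrix (κ₁ ⊕ κ₂) (κ₁ ⊕ κ₂) R => W.det) ?_
  ext i j
  rcases j with j | j <;> simp

/-- A nonzero term of the Leibniz formula would match the first block of columns bijectively with
the rows in `A`. -/
theorem det_splitRows_eq_zero_of_card (Z : Matrix ι (κ₁ ⊕ κ₂) R) (φ : κ₁ ⊕ κ₂ ≃ ι)
    {A : Finset ι} (hA : A.card ≠ Fintype.card κ₁) :
    ((splitRows Z A).submatrix φ id).det = 0 := by
  rw [Matrix.det_apply]
  refine Finset.sum_eq_zero fun σ _ => ?_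
  obtain ⟨j, hj⟩ : ∃ j, (splitRows Z A).submatrix φ id (σ j) j = 0 := by
    by_contra! hc
    apply hA
    have h : A = Finset.univ.map ((Function.Embedding.inl.trans σ.toEmbedding).trans
        φ.toEmbedding) := by
      ext i
      constructor
      · intro hi
        have h1 := hc (σ.symm (φ.symm i))
        rw [Matrix.submatrix_apply, Equiv.apply_symm_apply, Equiv.apply_symm_apply, id] at h1
        rcases h2 : σ.symm (φ.symm i) with j | j
        · rw [Finset.mem_map]
          refine ⟨j, Finset.mem_univ _, ?_⟩
          simp [← h2]
        · rw [h2, splitRows_inr_of_mem Z hi] at h1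
          exact absurd rfl h1
      · intro hi
        rw [Finset.mem_map] at hi
        obtain ⟨j, -, rfl⟩ := hi
        by_contra hi
        exact hc (Sum.inl j) (splitRows_inl_of_notMem Z hi j)
    rw [h, Finset.card_map, Finset.card_univ]
  have h0 : ∏ j, (splitRows Z A).submatrix φ id (σ j) j = 0 :=
    Finset.prod_eq_zero (Finset.mem_univ j) hj
  rw [h0, smul_zero]

theorem det_splitRows_eq_zero_of_row (Z : Matrix ι (κ₁ ⊕ κ₂) R) (φ : κ₁ ⊕ κ₂ ≃ ι)
    {A : Finset ι} {i : ι} (hi : i ∈ A) (h : ∀ j, Z i (Sum.inl j) = 0) :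
    ((splitRows Z A).submatrix φ id).det = 0 := by
  apply Matrix.det_eq_zero_of_row_eq_zero (φ.symm i)
  rintro (j | j)
  · simp [splitRows_inl_of_mem Z hi, h]
  · simp [splitRows_inr_of_mem Z hi]

/-- Listing the rows by `e` instead of `φ`, those in `A` first, makes the matrix block diagonal at
the cost of a sign. -/
theorem det_splitRows (Z : Matrix ι (κ₁ ⊕ κ₂) R) (φ e : κ₁ ⊕ κ₂ ≃ ι) {A : Finset ι}
    (h₁ : ∀ j, e (Sum.inl j) ∈ A) (h₂ : ∀ j, e (Sum.inr j) ∉ A) :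
    ((splitRows Z A).submatrix φ id).det =
      ((Equiv.Perm.sign (φ.trans e.symm) : ℤˣ) : ℤ) *
        ((Matrix.of fun i j => Z (e (Sum.inl i)) (Sum.inl j)).det *
          (Matrix.of fun i j => Z (e (Sum.inr i)) (Sum.inr j)).det) := by
  have h := Matrix.det_permute (φ.trans e.symm) ((splitRows Z A).submatrix e id)
  have hb : (splitRows Z A).submatrix e id = Matrix.fromBlocks
      (Matrix.of fun i j => Z (e (Sum.inl i)) (Sum.inl j)) 0 0
      (Matrix.of fun i j => Z (e (Sum.inr i)) (Sum.inr j)) := by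
    ext i j
    rcases i with i | i <;> rcases j with j | j
    · simp [splitRows_inl_of_mem Z (h₁ i)]
    · simp [splitRows_inr_of_mem Z (h₁ i)]
    · simp [splitRows_inl_of_notMem Z (h₂ i)]
    · simp [splitRows_inr_of_notMem Z (h₂ i)]
  rw [hb, Matrix.det_fromBlocks_zero₂₁, ← hb] at h
  rw [← h]
  congr 1
  ext i j
  simp

/-- The inversions are exactly the pairs formed by one element of each of the two exchanged blocks,
of sizes a and q. -/
theorem sign_of_swap_blocks {M p a q : ℕ} (h : p + a + q ≤ M) {π : Equiv.Perm (Fin M)}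
    (hπ : ∀ k, (π k : ℕ) = if (k : ℕ) < p then (k : ℕ) else if (k : ℕ) < p + a then k + q else
      if (k : ℕ) < p + a + q then k - a else k) :
    Equiv.Perm.sign π = (-1) ^ (q * a) := by
  have hc : ∀ u v : ℕ, u + v ≤ M → ∀ z : ℤˣ,
      ∏ i : Fin M, (if u ≤ (i : ℕ) ∧ (i : ℕ) < u + v then z else 1) = z ^ v := by
    intro u v huv z
    rw [Fin.prod_univ_eq_prod_range (fun i => if u ≤ i ∧ i < u + v then z else 1),
      ← Finset.prod_filter, Finset.prod_const]
    congr 1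
    have : (Finset.range M).filter (fun i => u ≤ i ∧ i < u + v) = Finset.Ico u (u + v) := by
      ext i
      simp
      omega
    rw [this, Nat.card_Ico]
    omega
  have h1 : ∀ i : Fin M, ∏ j ∈ Finset.Ioi i, (if π i < π j then (1 : ℤˣ) else -1) =
      if p ≤ (i : ℕ) ∧ (i : ℕ) < p + a then (-1) ^ q else 1 := by
    intro i
    rw [← Finset.filter_lt_eq_Ioi, Finset.prod_filter]
    split_ifs with hi
    · rw [← hc (p + a) q h]
      refine Finset.prod_congr rfl fun j _ => ?_
      simp only [Fin.lt_def, hπ]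
      split_ifs <;> first | rfl | omega
    · refine Finset.prod_eq_one fun j _ => ?_
      simp only [Fin.lt_def, hπ]
      split_ifs <;> first | rfl | omega
  rw [Equiv.Perm.sign_eq_prod_prod_Ioi, Finset.prod_congr rfl fun i _ => h1 i,
    hc p a (by omega), pow_mul]

end Laplace

/-! ### Signs of block rearrangements -/

section Signs

variable {R : Type*} [CommRing R]

/-- The sign of a bijection from two blocks, listed one after the other. -/
def sgnEquiv {p q m : ℕ} (hm : p + q = m) (e : Fin p ⊕ Fin q ≃ Fin m) : ℤˣ :=
  Equiv.Perm.sign (((finCongr hm).symm.trans finSumFinEquiv.symm).trans e)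

theorem delta_eq_prod_ite {n : ℕ} (x : Fin n → R) :
    delta x = ∏ i, ∏ j, if i < j then x i - x j else 1 := by
  rw [delta]
  refine Finset.prod_congr rfl fun i _ => ?_
  rw [← Finset.filter_lt_eq_Ioi, Finset.prod_filter]

theorem delta_append {p q : ℕ} (u : Fin p → R) (v : Fin q → R) :
    delta (Fin.append u v) = delta u * delta v * deltaPair u v := by
  rw [delta_eq_prod_ite, Fin.prod_univ_add, delta_eq_prod_ite u, delta_eq_prod_ite v, deltaPair,
    mul_right_comm, ← Finset.prod_mul_distrib]
  congr 1
  · refine Finset.prod_congr rfl fun i _ => ?_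
    rw [Fin.prod_univ_add]
    congr 1
    · refine Finset.prod_congr rfl fun j _ => ?_
      simp only [Fin.append_left, Fin.lt_def, Fin.val_castAdd]
    · refine Finset.prod_congr rfl fun j _ => ?_
      rw [if_pos, Fin.append_left, Fin.append_right]
      have := i.2
      rw [Fin.lt_def, Fin.val_castAdd, Fin.val_natAdd]
      omega
  · refine Finset.prod_congr rfl fun i _ => ?_
    rw [Fin.prod_univ_add, Finset.prod_eq_one, one_mul]
    · refine Finset.prod_congr rfl fun j _ => ?_
      simp
    · intro j _
      rw [if_neg]
      have := j.2
      rw [Fin.lt_def, Fin.val_castAdd, Fin.val_natAdd]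
      omega

/-- Δ is alternating, and Δ of the concatenation of the two parts factors. This absorbs the sign of
splitting Y into U and V. -/
theorem sgnEquiv_mul_delta {p q m : ℕ} (hm : p + q = m) (e : Fin p ⊕ Fin q ≃ Fin m)
    (y : Fin m → R) :
    ((sgnEquiv hm e : ℤ) : R) * delta y =
      delta (fun i => y (e (Sum.inl i))) * delta (fun i => y (e (Sum.inr i))) *
        deltaPair (fun i => y (e (Sum.inl i))) (fun i => y (e (Sum.inr i))) := by
  subst hm
  rw [← delta_append, sgnEquiv, delta, delta,
    ← Equiv.Perm.prod_Ioi_comp_eq_sign_mul_prod _ (f := fun i j => y i - y j)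
      fun i j => (neg_sub _ _).symm]
  have h : ∀ i, Fin.append (fun i => y (e (Sum.inl i))) (fun i => y (e (Sum.inr i))) i =
      y ((((finCongr rfl).symm.trans finSumFinEquiv.symm).trans e) i) := by
    intro i
    refine Fin.addCases (fun i => ?_) (fun i => ?_) i <;> simp
  simp only [h]

/-- The order preserving bijection between two and three consecutive blocks. -/
def stdEquiv {l M m r d : ℕ} (h : l + M = m + (r + d)) :
    Fin l ⊕ Fin M ≃ Fin m ⊕ (Fin r ⊕ Fin d) :=
  (finSumFinEquiv.trans (finCongr h)).trans
    (finSumFinEquiv.symm.trans (Equiv.sumCongr (Equiv.refl _) finSumFinEquiv.symm))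

/-- The position in the concatenation of three blocks. -/
def flatten {m r d : ℕ} : Fin m ⊕ (Fin r ⊕ Fin d) → ℕ :=
  Sum.elim (fun i => i) (Sum.elim (fun i => m + i) fun i => m + r + i)

theorem finSumFinEquiv_stdEquiv_symm {l M m r d : ℕ} (h : l + M = m + (r + d))
    (i : Fin m ⊕ (Fin r ⊕ Fin d)) :
    (finSumFinEquiv ((stdEquiv h).symm i) : ℕ) = flatten i := by
  rcases i with i | i | i <;> simp [stdEquiv, flatten, add_assoc]

/-- Two blocks are each divided into two parts, of which the first ones are moved to the front. -/
def blockEquiv {p q m a b r : ℕ} (eJ : Fin p ⊕ Fin q ≃ Fin m) (eI : Fin a ⊕ Fin b ≃ Fin r)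
    (d : ℕ) : Fin (p + a) ⊕ Fin (q + (b + d)) ≃ Fin m ⊕ (Fin r ⊕ Fin d) :=
  (Equiv.sumCongr finSumFinEquiv.symm
    (finSumFinEquiv.symm.trans (Equiv.sumCongr (Equiv.refl _) finSumFinEquiv.symm))).trans
    ((Equiv.sumSumSumComm (Fin p) (Fin a) (Fin q) (Fin b ⊕ Fin d)).trans
      (Equiv.sumCongr eJ ((Equiv.sumAssoc (Fin a) (Fin b) (Fin d)).symm.trans
        (Equiv.sumCongr eI (Equiv.refl _)))))

theorem sign_stdEquiv_blockEquiv {p q a b d : ℕ}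
    (h : (p + a) + (q + (b + d)) = (p + q) + ((a + b) + d)) :
    Equiv.Perm.sign ((stdEquiv h).trans (blockEquiv finSumFinEquiv finSumFinEquiv d).symm) =
      (-1) ^ (q * a) := by
  rw [← Equiv.Perm.sign_symm,
    ← Equiv.Perm.sign_symm_trans_trans _ finSumFinEquiv]
  apply sign_of_swap_blocks (p := p) (by omega)
  intro k
  simp only [Equiv.trans_apply, Equiv.symm_trans_apply, Equiv.symm_symm,
    finSumFinEquiv_stdEquiv_symm]
  refine Fin.addCases (fun k => ?_) (fun k => ?_) k
  · refine Fin.addCases (fun k => ?_) (fun k => ?_) k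
    · simp [blockEquiv, flatten]
    · simp [blockEquiv, flatten]
      omega
  · refine Fin.addCases (fun k => ?_) (fun k => ?_) k
    · simp [blockEquiv, flatten]
      split_ifs <;> omega
    · refine Fin.addCases (fun k => ?_) (fun k => ?_) k
      · simp [blockEquiv, flatten]
        omega
      · simp [blockEquiv, flatten]
        omega

/-- The rearrangement first sorts within the blocks of sizes m and r, which gives the two splitting
signs, and then exchanges the adjacent blocks of sizes q and a. -/
theorem sign_blockEquiv {p q m a b r d : ℕ} (hm : p + q = m) (hr : a + b = r)
    (h : (p + a) + (q + (b + d)) = m + (r + d)) (eJ : Fin p ⊕ Fin q ≃ Fin m)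
    (eI : Fin a ⊕ Fin b ≃ Fin r) :
    Equiv.Perm.sign ((stdEquiv h).trans (blockEquiv eJ eI d).symm) =
      (-1) ^ (q * a) * (sgnEquiv hm eJ * sgnEquiv hr eI) := by
  subst hm hr
  rw [← sign_stdEquiv_blockEquiv h, sgnEquiv, sgnEquiv]
  set G : Equiv.Perm (Fin (p + q) ⊕ (Fin (a + b) ⊕ Fin d)) :=
    Equiv.Perm.sumCongr (((finCongr rfl).symm.trans finSumFinEquiv.symm).trans eJ)
      (Equiv.Perm.sumCongr (((finCongr rfl).symm.trans finSumFinEquiv.symm).trans eI) 1) with hG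
  have h1 : blockEquiv eJ eI d = (blockEquiv finSumFinEquiv finSumFinEquiv d).trans G := by
    refine Equiv.ext fun x => ?_
    rcases x with x | x
    · refine Fin.addCases (fun x => ?_) (fun x => ?_) x <;> simp [blockEquiv, hG]
    · refine Fin.addCases (fun x => ?_) (fun x => ?_) x
      · simp [blockEquiv, hG]
      · refine Fin.addCases (fun x => ?_) (fun x => ?_) x <;> simp [blockEquiv, hG]
  have h2 : (stdEquiv h).trans (blockEquiv eJ eI d).symm =
      (((stdEquiv h).symm.symm.trans G.symm).trans (stdEquiv h).symm).trans
        ((stdEquiv h).trans (blockEquiv finSumFinEquiv finSumFinEquiv d).symm) := by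
    rw [h1]
    ext x
    simp
  rw [h2, ← Equiv.Perm.mul_def, Equiv.Perm.sign_mul, Equiv.Perm.sign_symm_trans_trans,
    Equiv.Perm.sign_symm, hG, Equiv.Perm.sign_sumCongr, Equiv.Perm.sign_sumCongr]
  simp

end Signs

/-! ### Overlaps as choices of subsets -/

section Overlap

variable {R : Type*} [CommRing R]

/-- A pair with overlap κ is a division of the strictly decreasing sequence κ + ρ into two
subsequences: I is the set of positions of μ + ρ_a, and the sorting permutation lists I and then its
complement, each in increasing order. -/
theorem sum_powersetCard_eq_finsum_isOverlap {a b r : ℕ} (hr : a + b = r) {kap : YoungDiagram}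
    (hk : kap.colLen 0 ≤ r) (G : Finset (Fin r) → R) (g : YoungDiagram × YoungDiagram → R)
    (hG : ∀ (I : Finset (Fin r)) (hI : I.card = a) (hI' : Iᶜ.card = b) (mu nu : YoungDiagram),
      mu.colLen 0 ≤ a → nu.colLen 0 ≤ b →
      IsOverlap a b mu nu kap →
      (∀ i, addRho a mu i = addRho r kap (finSumEquivOfFinset hI hI' (Sum.inl i))) →
      (∀ i, addRho b nu i = addRho r kap (finSumEquivOfFinset hI hI' (Sum.inr i))) →
      overlapSign a b mu nu = sgnEquiv hr (finSumEquivOfFinset hI hI') →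
      G I = g (mu, nu)) :
    ∑ I ∈ Finset.powersetCard a Finset.univ, G I =
      ∑ᶠ q ∈ {q : YoungDiagram × YoungDiagram | IsOverlap a b q.1 q.2 kap}, g q := by
  classical
  subst hr
  have hβ := strictAnti_addRho (a + b) kap
  rw [finsum_mem_eq_finite_toFinset_sum g (finite_isOverlap a b kap)]
  have hcard : ∀ I ∈ Finset.powersetCard a (Finset.univ : Finset (Fin (a + b))),
      I.card = a ∧ Iᶜ.card = b := by
    intro I hI
    have h1 := (Finset.mem_powersetCard.1 hI).2
    rw [Finset.card_compl, h1, Fintype.card_fin]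
    omega
  have hmu : ∀ I (hI : I ∈ Finset.powersetCard a (Finset.univ : Finset (Fin (a + b)))),
      ∃ mu : YoungDiagram, mu.colLen 0 ≤ a ∧
        addRho a mu = addRho (a + b) kap ∘ I.orderEmbOfFin (hcard I hI).1 := fun I hI =>
    exists_addRho_eq (hβ.comp_strictMono (OrderEmbedding.strictMono _))
  have hnu : ∀ I (hI : I ∈ Finset.powersetCard a (Finset.univ : Finset (Fin (a + b)))),
      ∃ nu : YoungDiagram, nu.colLen 0 ≤ b ∧
        addRho b nu = addRho (a + b) kap ∘ Iᶜ.orderEmbOfFin (hcard I hI).2 := fun I hI =>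
    exists_addRho_eq (hβ.comp_strictMono (OrderEmbedding.strictMono _))
  choose mu hmu1 hmu2 using hmu
  choose nu hnu1 hnu2 using hnu
  have hsort : ∀ I (hI : I ∈ Finset.powersetCard a (Finset.univ : Finset (Fin (a + b)))),
      IsSorting a b (mu I hI) (nu I hI) kap (((finCongr rfl).symm.trans finSumFinEquiv.symm).trans
        (finSumEquivOfFinset (hcard I hI).1 (hcard I hI).2)) := by
    refine fun I hI => ⟨hmu1 I hI, hnu1 I hI, hk, fun i => ?_⟩
    rw [hmu2, hnu2]
    refine Fin.addCases (fun i => ?_) (fun i => ?_) i <;> simp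
  refine Finset.sum_bij (fun I hI => (mu I hI, nu I hI)) ?_ ?_ ?_ ?_
  · intro I hI
    simp only [Set.Finite.mem_toFinset, Set.mem_ofPred_eq]
    exact ⟨_, hsort I hI⟩
  · intro I hI I' hI' h
    have h1 : mu I hI = mu I' hI' := congrArg Prod.fst h
    have h2 := (hmu2 I hI).symm.trans ((congrArg (addRho a) h1).trans (hmu2 I' hI'))
    have h3 := congrArg Set.range (hβ.injective.comp_left h2)
    rw [Finset.range_orderEmbOfFin, Finset.range_orderEmbOfFin] at h3
    exact_mod_cast h3
  · rintro ⟨mu', nu'⟩ hq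
    simp only [Set.Finite.mem_toFinset, Set.mem_ofPred_eq] at hq
    obtain ⟨σ, h1, h2, -, h3⟩ := hq
    have hmono1 : StrictMono fun i : Fin a => σ (Fin.castAdd b i) := by
      intro i j hij
      have := strictAnti_addRho a mu' hij
      have h4 := h3 (Fin.castAdd b i)
      have h5 := h3 (Fin.castAdd b j)
      rw [Fin.append_left] at h4 h5
      rw [h4, h5] at this
      exact hβ.lt_iff_gt.1 this
    have hmono2 : StrictMono fun i : Fin b => σ (Fin.natAdd a i) := by
      intro i j hij
      have := strictAnti_addRho b nu' hij
      have h4 := h3 (Fin.natAdd a i)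
      have h5 := h3 (Fin.natAdd a j)
      rw [Fin.append_right] at h4 h5
      rw [h4, h5] at this
      exact hβ.lt_iff_gt.1 this
    -- The positions to which `σ` sends the entries of μ + ρ_a. By `hmono1` and `hmono2` it lists
    -- them and their complement increasingly, so the pair is recovered from them.
    set I := Finset.univ.map ((Fin.castAddEmb b).trans σ.toEmbedding) with hI
    have hIm : I ∈ Finset.powersetCard a (Finset.univ : Finset (Fin (a + b))) := by
      rw [Finset.mem_powersetCard]
      simp [hI]
    refine ⟨I, hIm, Prod.ext (addRho_injective (hmu1 I hIm) h1 ?_)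
      (addRho_injective (hnu1 I hIm) h2 ?_)⟩
    · rw [hmu2, ← Finset.orderEmbOfFin_unique (hcard I hIm).1 (fun i => ?_) hmono1]
      · ext i
        rw [Function.comp_apply, ← h3, Fin.append_left]
      · simp [hI]
    · rw [hnu2, ← Finset.orderEmbOfFin_unique (hcard I hIm).2 (fun i => ?_) hmono2]
      · ext i
        rw [Function.comp_apply, ← h3, Fin.append_right]
      · rw [Finset.mem_compl, hI, Finset.mem_map]
        rintro ⟨j, -, hj⟩
        have := congrArg Fin.val (σ.injective hj)
        simp at this
        omega
  · intro I hI
    exact hG I (hcard I hI).1 (hcard I hI).2 _ _ (hmu1 I hI) (hnu1 I hI) ⟨_, hsort I hI⟩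
      (fun i => congrFun (hmu2 I hI) i) (fun i => congrFun (hnu2 I hI) i)
      (overlapSign_eq (hsort I hI))

end Overlap

/-! ### The two evaluations of the determinant -/

section Assembly

variable {R : Type*} [CommRing R]

theorem det_vandermonde_neg {m : ℕ} (y : Fin m → R) :
    (Matrix.vandermonde (-y)).det = delta y := by
  rw [Matrix.det_vandermonde, delta]
  refine Finset.prod_congr rfl fun i _ => Finset.prod_congr rfl fun j _ => ?_
  simp only [Pi.neg_apply]
  ring

theorem deltaPair_neg_neg {a b : ℕ} (x : Fin a → R) (y : Fin b → R) :
    deltaPair (-x) (-y) = deltaPair y x := by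
  rw [deltaPair, deltaPair, Finset.prod_comm]
  refine Finset.prod_congr rfl fun i _ => Finset.prod_congr rfl fun j _ => ?_
  simp only [Pi.neg_apply]
  ring

theorem deltaPair_comm {a b : ℕ} (x : Fin a → R) (y : Fin b → R) :
    deltaPair x y = (-1) ^ (a * b) * deltaPair y x := by
  have h : deltaPair x y = ∏ i, ∏ j, (-1) * (y j - x i) :=
    Finset.prod_congr rfl fun i _ => Finset.prod_congr rfl fun j _ => by ring
  rw [h]
  simp only [Finset.prod_mul_distrib, Finset.prod_const, Finset.card_univ, Fintype.card_fin,
    ← pow_mul]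
  rw [deltaPair, Finset.prod_comm, mul_comm b a]

/-- A common factor t(u) of the columns scales the evaluation row at w_i by t(w_i), and in the
coefficient rows it moves into the series and shifts the index by n; `h` absorbs the shift into α'.
-/
theorem det_mixedFunctional_rootPoly {m N n : ℕ} (M : ℕ) (f : PowerSeries R) (w : Fin m → R)
    (t : Fin n → R) (α α' : Fin N → ℕ) (h : ∀ k, (α k : ℤ) + 1 - M + n = α' k + 1 - (m + N : ℕ)) :
    (Matrix.of fun i j : Fin (m + N) => mixedFunctional M f w α (finSumFinEquiv.symm i)
      (rootPoly t * Polynomial.X ^ (j : ℕ))).det =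
      deltaPair w t * ((Matrix.vandermonde w).det *
        jacobiDet (oneSubProd w * (oneSubProd t * f)) α') := by
  rw [← det_mixedFunctional]
  have h1 := Matrix.det_mul_column
    (fun i : Fin (m + N) => Sum.elim (fun i => ∏ k, (w i - t k)) (fun _ => 1)
      (finSumFinEquiv.symm i))
    (Matrix.of fun i b : Fin (m + N) =>
      mixedFunctional (m + N) (oneSubProd t * f) w α' (finSumFinEquiv.symm i)
        (Polynomial.X ^ (b : ℕ)))
  have h2 : ∏ i : Fin (m + N), (Sum.elim (fun i => ∏ k, (w i - t k)) (fun _ => (1 : R))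
      (finSumFinEquiv.symm i)) = deltaPair w t := by
    rw [Fin.prod_univ_add]
    simp [deltaPair]
  rw [h2] at h1
  rw [← h1]
  congr 1
  ext i j
  refine Fin.addCases (fun i => ?_) (fun i => ?_) i
  · simp [mixedFunctional, eval_rootPoly]
  · simp only [Matrix.of_apply, finSumFinEquiv_symm_apply_natAdd, mixedFunctional, Sum.elim_inr,
      shiftFunctional_rootPoly_mul, Fintype.card_fin, h, one_mul]

/-- The values of evaluations and coefficient functionals on the multiples of `rootPoly t` and
`rootPoly s`. -/
noncomputable def overlapMatrix {m r d l n : ℕ} (M : ℕ) (w : Fin m → R) (α : Fin r ⊕ Fin d → ℕ)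
    (s : Fin l → R) (t : Fin n → R) : Matrix (Fin m ⊕ (Fin r ⊕ Fin d)) (Fin l ⊕ Fin M) R :=
  Matrix.of fun i c => mixedFunctional (m + (r + d)) (geomProd s * geomProd t) w α i
    (Sum.elim (fun j : Fin l => rootPoly t * Polynomial.X ^ (j : ℕ))
      (fun j : Fin M => rootPoly s * Polynomial.X ^ (j : ℕ)) c)

/-- All columns are polynomials of degree less than l + M (this uses n ≤ M), so the matrix factors
through their coefficients, which form the Sylvester matrix. -/
theorem det_overlapMatrix {m r d l n M : ℕ} (h : l + M = m + (r + d)) (hn : n ≤ M)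
    (w : Fin m → R) (α : Fin (r + d) → ℕ) (s : Fin l → R) (t : Fin n → R) :
    ((overlapMatrix M w (α ∘ finSumFinEquiv) s t).submatrix (stdEquiv h) id).det =
      (Matrix.vandermonde w).det * jacobiDet (oneSubProd w * (geomProd s * geomProd t)) α *
        deltaPair s t := by
  nontriviality R
  rw [← det_mixedFunctional, ← det_coeff_rootPoly hn,
    ← Matrix.det_submatrix_equiv_self (finCongr h.symm)]
  set Q : Fin (l + M) → Polynomial R := fun j => Fin.addCases
      (fun j : Fin l => rootPoly t * Polynomial.X ^ (j : ℕ))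
      (fun j : Fin M => rootPoly s * Polynomial.X ^ (j : ℕ)) j with hQ
  have h1 := det_functionals
    (fun i => mixedFunctional (m + (r + d)) (geomProd s * geomProd t) w α (finSumFinEquiv.symm i))
    (fun j => Q (finCongr h.symm j)) ?_
  · rw [← Matrix.det_submatrix_equiv_self (finSumFinEquiv.trans (finCongr h))] at h1
    refine Eq.trans ?_ (h1.trans ?_)
    · congr 1
      ext i j
      rw [Matrix.submatrix_apply, Matrix.submatrix_apply, Matrix.of_apply, overlapMatrix,
        Matrix.of_apply]
      have h2 : Q (finCongr h.symm ((finSumFinEquiv.trans (finCongr h)) j)) =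
          Sum.elim (fun j : Fin l => rootPoly t * Polynomial.X ^ (j : ℕ))
            (fun j : Fin M => rootPoly s * Polynomial.X ^ (j : ℕ)) j := by
        rcases j with j | j <;> simp [hQ]
      rw [h2, id, stdEquiv, Equiv.trans_apply]
      congr 1
      rcases hk : finSumFinEquiv.symm ((finSumFinEquiv.trans (finCongr h)) i) with k | k
      all_goals
        simp only [Equiv.trans_apply] at hk ⊢
        rw [hk]
        simp [mixedFunctional]
    · congr 1
  · intro j
    rw [Polynomial.degree_lt_iff_coeff_zero]
    intro b hb
    refine Polynomial.coeff_eq_zero_of_natDegree_lt (lt_of_lt_of_le ?_ (h.le.trans hb))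
    refine Fin.addCases (fun j => ?_) (fun j => ?_) (finCongr h.symm j)
    · simp only [hQ, Fin.addCases_left]
      rw [(monic_rootPoly t).natDegree_mul (Polynomial.monic_X_pow _), natDegree_rootPoly,
        Polynomial.natDegree_X_pow, Fintype.card_fin]
      omega
    · simp only [hQ, Fin.addCases_right]
      rw [(monic_rootPoly s).natDegree_mul (Polynomial.monic_X_pow _), natDegree_rootPoly,
        Polynomial.natDegree_X_pow, Fintype.card_fin]
      omega

/-- In the first minor t(u) cancels the t-part of the series, in the second s(u) cancels the s-part.
Only `h₁` carries a real shift; in the second minor the index shift by p + a is exactly the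
difference of the sizes. -/
theorem det_split_overlapMatrix {p q m a b r d n : ℕ} (hm : p + q = m) (hr : a + b = r)
    (h : (p + a) + (q + (b + d)) = m + (r + d)) (eJ : Fin p ⊕ Fin q ≃ Fin m)
    (eI : Fin a ⊕ Fin b ≃ Fin r) (w : Fin m → R) (α : Fin r ⊕ Fin d → ℕ)
    (s : Fin (p + a) → R) (t : Fin n → R) (α₁ : Fin a → ℕ) (α₂ : Fin (b + d) → ℕ)
    (h₁ : ∀ i, (α (Sum.inl (eI (Sum.inl i))) : ℤ) + 1 - (m + (r + d) : ℕ) + n =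
      α₁ i + 1 - (p + a : ℕ))
    (h₂ : ∀ i, α₂ (Fin.castAdd d i) = α (Sum.inl (eI (Sum.inr i))))
    (h₃ : ∀ i, α₂ (Fin.natAdd b i) = α (Sum.inr i))
    {J : Finset (Fin m)} {I : Finset (Fin r)}
    (hJ₁ : ∀ i, eJ (Sum.inl i) ∈ J) (hJ₂ : ∀ i, eJ (Sum.inr i) ∉ J)
    (hI₁ : ∀ i, eI (Sum.inl i) ∈ I) (hI₂ : ∀ i, eI (Sum.inr i) ∉ I) :
    ((splitRows (overlapMatrix (q + (b + d)) w α s t) (J.disjSum (I.disjSum ∅))).submatrix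
      (stdEquiv h) id).det =
      (-1) ^ (q * a) * ((sgnEquiv hm eJ : ℤ) * (sgnEquiv hr eI : ℤ)) *
        ((deltaPair (fun i => w (eJ (Sum.inl i))) t *
          ((Matrix.vandermonde fun i => w (eJ (Sum.inl i))).det *
            jacobiDet (oneSubProd (fun i => w (eJ (Sum.inl i))) * geomProd s) α₁)) *
        (deltaPair (fun i => w (eJ (Sum.inr i))) s *
          ((Matrix.vandermonde fun i => w (eJ (Sum.inr i))).det *
            jacobiDet (oneSubProd (fun i => w (eJ (Sum.inr i))) * geomProd t) α₂))) := by
  have hs : oneSubProd s * (geomProd s * geomProd t) = geomProd t := by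
    rw [← mul_assoc, oneSubProd_mul_geomProd, one_mul]
  have ht : oneSubProd t * (geomProd s * geomProd t) = geomProd s := by
    rw [mul_left_comm, oneSubProd_mul_geomProd, mul_one]
  have hd₁ := det_mixedFunctional_rootPoly (m + (r + d)) (geomProd s * geomProd t)
    (fun i => w (eJ (Sum.inl i))) t (fun i => α (Sum.inl (eI (Sum.inl i)))) α₁ h₁
  have hd₂ := det_mixedFunctional_rootPoly (m + (r + d)) (geomProd s * geomProd t)
    (fun i => w (eJ (Sum.inr i))) s α₂ α₂ (fun i => by omega)
  rw [ht] at hd₁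
  rw [hs] at hd₂
  rw [← hd₁, ← hd₂, det_splitRows _ _ (blockEquiv eJ eI d), sign_blockEquiv hm hr]
  · congr 1
    · simp
    · congr 2
      · ext i j
        refine Fin.addCases (fun i => ?_) (fun i => ?_) i <;>
          simp [overlapMatrix, blockEquiv, mixedFunctional]
      · ext i j
        refine Fin.addCases (fun i => ?_) (fun i => ?_) i
        · simp [overlapMatrix, blockEquiv, mixedFunctional]
        · refine Fin.addCases (fun i => ?_) (fun i => ?_) i <;>
            simp [overlapMatrix, blockEquiv, mixedFunctional, h₂, h₃]
  · refine Fin.addCases (fun i => ?_) (fun i => ?_)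
    · simp [blockEquiv, hJ₁]
    · simp [blockEquiv, hI₁]
  · refine Fin.addCases (fun i => ?_) (fun i => ?_)
    · simp [blockEquiv, hJ₂]
    · refine Fin.addCases (fun i => ?_) (fun i => ?_) i
      · simp [blockEquiv, hI₂]
      · simp [blockEquiv]

end Assembly

/-! ### One Laplace term, the vanishing terms and the theorem -/

section Main

variable {F : Type*} [Field F]

theorem colLen_takeRows_le (r : ℕ) (lam : YoungDiagram) : (takeRows r lam).colLen 0 ≤ r := by
  rw [← rowLen_eq_zero_iff, rowLen_takeRows, if_neg (lt_irrefl r)]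

/-- The Vandermonde determinants of U and V cancel against Δ(Y), leaving Δ(V; U) in the denominator;
the factors s(w) and t(w) become Δ(V; S) and Δ(T; U). -/
theorem det_split_div_eq {n m l n' r d M a b : ℕ} {k : ℤ} {lam : YoungDiagram}
    (hk : IsIndex m n lam k) (hn : l + n' = n) (hr : r = ((n : ℤ) - k).toNat)
    (hd : lam.colLen 0 ≤ d) (h : l + M = m + (r + d)) (S : Fin l → F) (T : Fin n' → F)
    (Y : Fin m → F) (hY : delta Y ≠ 0) (hST : deltaPair S T ≠ 0) (J : Finset (Fin m))
    (hl : J.card + a = l) (hab : a + b = r) (I : Finset (Fin r)) (hI : I.card = a)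
    (hI' : Iᶜ.card = b) {mu nu : YoungDiagram} (hov : IsOverlap a b mu nu (takeRows r lam))
    (hmu : ∀ i, addRho a mu i =
      addRho r (takeRows r lam) (finSumEquivOfFinset hI hI' (Sum.inl i)))
    (hnu : ∀ i, addRho b nu i =
      addRho r (takeRows r lam) (finSumEquivOfFinset hI hI' (Sum.inr i)))
    (hsgn : overlapSign a b mu nu = sgnEquiv hab (finSumEquivOfFinset hI hI')) :
    ((splitRows (overlapMatrix M (-Y) (addRho (r + d) lam ∘ finSumFinEquiv) (-S) (-T))
      (J.disjSum (I.disjSum ∅))).submatrix (stdEquiv h) id).det / (delta Y * deltaPair T S) =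
      deltaPair (subseq Y Jᶜ) S * deltaPair T (subseq Y J) /
          (deltaPair (subseq Y Jᶜ) (subseq Y J) * deltaPair T S) *
        ((overlapSign a b mu nu : ℤ) : F) *
        LS (subRect mu ((m : ℤ) - k).toNat a) (-S) (subseq Y J) *
        LS (concat b nu (dropRows r lam)) (-T) (subseq Y Jᶜ) := by
  have hJc : J.card + Jᶜ.card = m := by simp [Finset.card_add_card_compl]
  set q := Jᶜ.card with hq
  have hkm := hk.1.1
  obtain rfl : M = q + (b + d) := by omega
  subst hl
  have hsub := fun i => IsOverlap.rowLen_subRect hk (hr.symm.trans hab.symm)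
    (show IsOverlap a b mu nu (takeRows ((n : ℤ) - k).toNat lam) by rwa [← hr]) i
  have hcon := fun i => IsOverlap.rowLen_concat
    (show IsOverlap a b mu nu (takeRows (a + b) lam) by rwa [hab]) i
  rw [hab] at hcon
  have hlen₁ : (subRect mu ((m : ℤ) - k).toNat a).colLen 0 ≤ a := by
    have h1 := hsub a
    have h2 := (rowLen_eq_zero_iff mu a).2 hov.choose_spec.1
    rw [if_neg (lt_irrefl a), h2] at h1
    rw [← rowLen_eq_zero_iff]
    omega
  have hlen₂ : (concat b nu (dropRows r lam)).colLen 0 ≤ b + d := by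
    rw [← rowLen_eq_zero_iff, hcon, if_neg (by omega), rowLen_eq_zero_iff]
    omega
  have hrow : ∀ i : Fin r, addRho (r + d) lam (Fin.castAdd d i) =
      addRho r (takeRows r lam) i + d := by
    intro i
    have := i.2
    simp only [addRho, Fin.val_castAdd, rowLen_takeRows, if_pos i.2]
    omega
  -- The exponents of the first minor drop by m + r - n = m - k, since l + n' = n and r = n - k.
  -- This is the origin of the rectangle subtracted from μ.
  have key := det_split_overlapMatrix hJc hab h (finSumEquivOfFinset rfl rfl)
    (finSumEquivOfFinset hI hI') (-Y) (addRho (r + d) lam ∘ finSumFinEquiv) (-S) (-T)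
    (addRho a (subRect mu ((m : ℤ) - k).toNat a)) (addRho (b + d) (concat b nu (dropRows r lam)))
    (fun i => by
      have h1 := hsub i
      have h2 := hmu i
      have := i.2
      rw [if_pos i.2] at h1
      rw [Function.comp_apply, finSumFinEquiv_apply_left, hrow, ← h2]
      simp only [addRho]
      omega)
    (fun i => by
      have := i.2
      rw [Function.comp_apply, finSumFinEquiv_apply_left, hrow, ← hnu]
      simp only [addRho, hcon, Fin.val_castAdd, if_pos i.2]
      omega)
    (fun i => by
      have := i.2
      rw [Function.comp_apply, finSumFinEquiv_apply_right]
      simp only [addRho, hcon, Fin.val_natAdd]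
      rw [if_neg (by omega), show a + (b + (i : ℕ)) = r + i by omega]
      omega)
    (J := J) (I := I) (fun i => Finset.orderEmbOfFin_mem J rfl i)
    (fun i => Finset.mem_compl.1 (Finset.orderEmbOfFin_mem Jᶜ rfl i))
    (fun i => Finset.orderEmbOfFin_mem I hI i)
    (fun i => Finset.mem_compl.1 (Finset.orderEmbOfFin_mem Iᶜ hI' i))
  rw [key, LS_eq_jacobiDet hlen₁, LS_eq_jacobiDet hlen₂, hsgn]
  have hU : (fun i => (-Y) (finSumEquivOfFinset (s := J) rfl rfl (Sum.inl i))) =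
      -subseq Y J := rfl
  have hV : (fun i => (-Y) (finSumEquivOfFinset (s := J) rfl rfl (Sum.inr i))) =
      -subseq Y Jᶜ := rfl
  rw [hU, hV, det_vandermonde_neg, det_vandermonde_neg, deltaPair_neg_neg, deltaPair_neg_neg,
    deltaPair_comm S]
  have hdelta := sgnEquiv_mul_delta hJc (finSumEquivOfFinset (s := J) rfl rfl) Y
  have hU' : (fun i => Y (finSumEquivOfFinset (s := J) rfl rfl (Sum.inl i))) =
      subseq Y J := rfl
  have hV' : (fun i => Y (finSumEquivOfFinset (s := J) rfl rfl (Sum.inr i))) =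
      subseq Y Jᶜ := rfl
  rw [hU', hV', deltaPair_comm (subseq Y J)] at hdelta
  have hTS : deltaPair T S ≠ 0 := by
    rw [deltaPair_comm] at hST
    exact right_ne_zero_of_mul hST
  set ε := sgnEquiv hJc (finSumEquivOfFinset (s := J) rfl rfl)
  have hε : ((ε : ℤ) : F) * ((ε : ℤ) : F) = 1 := by
    rw [← Int.cast_mul, ← Units.val_mul, Int.units_mul_self]
    simp
  have hΔ : delta Y = (ε : ℤ) * (delta (subseq Y J) * delta (subseq Y Jᶜ) *
      ((-1) ^ (J.card * q) * deltaPair (subseq Y Jᶜ) (subseq Y J))) := by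
    rw [← hdelta, ← mul_assoc, hε, one_mul]
  have hVU : deltaPair (subseq Y Jᶜ) (subseq Y J) ≠ 0 := by
    intro h0
    rw [h0] at hΔ
    exact hY (by rw [hΔ]; ring)
  rw [div_mul_eq_mul_div, div_mul_eq_mul_div, div_mul_eq_mul_div,
    div_eq_div_iff (mul_ne_zero hY hTS) (mul_ne_zero hVU hTS), hΔ]
  -- The three signs come from exchanging the blocks of rows, from turning Δ(S; V) into Δ(V; S), and
  -- from turning Δ(U; V) into Δ(V; U).
  have hsign : ((-1 : F) ^ (q * a)) * (-1) ^ ((J.card + a) * q) = (-1) ^ (J.card * q) := by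
    rw [← pow_add, show q * a + (J.card + a) * q = J.card * q + 2 * (q * a) by ring, pow_add,
      pow_mul (-1 : F) 2]
    simp
  rw [← hsign]
  ring

theorem det_split_eq_zero_of_card {m l n' r d M : ℕ} (h : l + M = m + (r + d)) (w : Fin m → F)
    (α : Fin r ⊕ Fin d → ℕ) (s : Fin l → F) (t : Fin n' → F) {J : Finset (Fin m)}
    {I : Finset (Fin r)} (hJI : J.card + I.card ≠ l) :
    ((splitRows (overlapMatrix M w α s t) (J.disjSum (I.disjSum ∅))).submatrix
      (stdEquiv h) id).det = 0 := by
  apply det_splitRows_eq_zero_of_card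
  simpa using hJI

/-- A row belonging to a part after the first r = n - k vanishes on the columns t(u)u^j, because
λ_{r+1} ≤ m - k makes all its indices negative. So it is never chosen for the first block. -/
theorem det_overlapMatrix_eq_sum {n m l n' r d M : ℕ} {k : ℤ} {lam : YoungDiagram}
    (hk : IsIndex m n lam k) (hn : l + n' = n) (hr : r = ((n : ℤ) - k).toNat)
    (h : l + M = m + (r + d)) (w : Fin m → F) (s : Fin l → F) (t : Fin n' → F) :
    ((overlapMatrix M w (addRho (r + d) lam ∘ finSumFinEquiv) s t).submatrix
      (stdEquiv h) id).det = ∑ J : Finset (Fin m), ∑ I : Finset (Fin r),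
      ((splitRows (overlapMatrix M w (addRho (r + d) lam ∘ finSumFinEquiv) s t)
        (J.disjSum (I.disjSum ∅))).submatrix (stdEquiv h) id).det := by
  have hkm := hk.1.1
  have hkf := hk.1.2
  -- Rows count from 0: `lam.rowLen r` is λ_{n+1-k}, and the point of the index definition lies
  -- outside the diagram.
  have hlam : (lam.rowLen r : ℤ) ≤ m - k := by
    by_contra hc
    apply hkf
    refine ⟨by omega, by omega, ?_⟩
    rw [show ((n : ℤ) + 1 - k - 1).toNat = r by omega]
    omega
  rw [det_eq_sum_splitRows, ← Fintype.sum_prod_type']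
  symm
  apply Fintype.sum_of_injective
    (fun q : Finset (Fin m) × Finset (Fin r) => q.1.disjSum (q.2.disjSum (∅ : Finset (Fin d))))
  · rintro ⟨J, I⟩ ⟨J', I'⟩ hq
    simpa [Finset.disjSum_inj] using hq
  · intro A hA
    by_cases hA' : ∃ i : Fin d, Sum.inr (Sum.inr i) ∈ A
    · obtain ⟨i, hi⟩ := hA'
      apply det_splitRows_eq_zero_of_row _ _ hi
      intro j
      have ht : oneSubProd t * (geomProd s * geomProd t) = geomProd s := by
        rw [mul_left_comm, oneSubProd_mul_geomProd, mul_one]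
      have h1 := lam.rowLen_anti r (r + i) (by omega)
      have h2 := i.2
      have h3 := j.2
      simp only [overlapMatrix, mixedFunctional, Matrix.of_apply, Sum.elim_inr, Sum.elim_inl,
        shiftFunctional_rootPoly_mul, shiftFunctional_X_pow, ht]
      apply coeffInt_of_neg
      simp only [Function.comp_apply, finSumFinEquiv_apply_right, addRho, Fin.val_natAdd,
        Fintype.card_fin]
      omega
    · exfalso
      apply hA
      refine ⟨(A.toLeft, A.toRight.toLeft), ?_⟩
      ext (i | i | i)
      · simp
      · simp
      · simpa using fun hi => hA' ⟨i, hi⟩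
  · exact fun _ => rfl

theorem geomProd_neg_append {l n' : ℕ} (S : Fin l → F) (T : Fin n' → F) :
    geomProd (-Fin.append S T) = geomProd (-S) * geomProd (-T) := by
  rw [geomProd, Fin.prod_univ_add, geomProd, geomProd]
  simp

end Main

end LittlewoodSchur

theorem mainTheorem1 {F : Type*} [Field F] (n m l : ℕ) (k : ℤ) (lam : YoungDiagram)
    (hk : IsIndex m n lam k) (hl : (l : ℤ) ≤ min ((n : ℤ) - k) n)
    (S : Fin l → F) (T : Fin (n - l) → F) (Y : Fin m → F)
    (hY : delta Y ≠ 0) (hST : deltaPair S T ≠ 0) :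
    LS lam (-Fin.append S T) Y =
      ∑ p ∈ Finset.range (min l m + 1),
        ∑ A ∈ Finset.powersetCard p (Finset.univ : Finset (Fin m)),
          ∑ᶠ q ∈ {q : YoungDiagram × YoungDiagram |
              IsOverlap (l - p) ((n : ℤ) - k - l + p).toNat q.1 q.2 (takeRows ((n : ℤ) - k).toNat lam)},
            deltaPair (subseq Y Aᶜ) S * deltaPair T (subseq Y A) /
                (deltaPair (subseq Y Aᶜ) (subseq Y A) * deltaPair T S) *
              ((overlapSign (l - p) ((n : ℤ) - k - l + p).toNat q.1 q.2 : ℤ) : F) *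
              LS (subRect q.1 ((m : ℤ) - k).toNat (l - p)) (-S) (subseq Y A) *
              LS (concat ((n : ℤ) - k - l + p).toNat q.2 (dropRows ((n : ℤ) - k).toNat lam)) (-T)
                (subseq Y Aᶜ) := by
  set r := ((n : ℤ) - k).toNat with hr
  set d := lam.colLen 0 with hd
  have hkm := hk.1.1
  -- M makes the matrix square; l ≤ n - k guarantees that the subtraction is not truncated.
  obtain ⟨M, h⟩ : ∃ M, l + M = m + (r + d) := ⟨m + (r + d) - l, by omega⟩
  have hTS : deltaPair T S ≠ 0 := by
    rw [deltaPair_comm] at hST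
    exact right_ne_zero_of_mul hST
  have hc : delta Y * deltaPair T S ≠ 0 := mul_ne_zero hY hTS
  have hdet := det_overlapMatrix h (by omega) (-Y) (addRho (r + d) lam) (-S) (-T)
  rw [det_overlapMatrix_eq_sum hk (by omega) hr, det_vandermonde_neg, deltaPair_neg_neg,
    ← geomProd_neg_append, ← LS_eq_jacobiDet (by omega), mul_right_comm] at hdet
  rw [eq_comm, mul_comm, ← eq_div_iff hc] at hdet
  rw [hdet, Finset.sum_div]
  simp only [Finset.sum_div]
  -- The sets J are sorted by size p. Sizes above l contribute nothing, as the first block takes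
  -- exactly l rows.
  rw [← Finset.powerset_univ, Finset.sum_powerset, Finset.card_univ, Fintype.card_fin]
  symm
  apply Finset.sum_subset_zero_on_sdiff
  · intro p
    simp only [Finset.mem_range]
    omega
  · intro p hp
    rw [Finset.mem_sdiff, Finset.mem_range, Finset.mem_range] at hp
    refine Finset.sum_eq_zero fun J hJ => Finset.sum_eq_zero fun I _ => ?_
    have hJ' := (Finset.mem_powersetCard.1 hJ).2
    rw [det_split_eq_zero_of_card h, zero_div]
    omega
  · intro p hp
    rw [Finset.mem_range] at hp
    refine Finset.sum_congr rfl fun J hJ => ?_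
    obtain rfl := (Finset.mem_powersetCard.1 hJ).2
    have hab : (l - J.card) + ((n : ℤ) - k - l + J.card).toNat = r := by omega
    rw [← sum_powersetCard_eq_finsum_isOverlap hab (colLen_takeRows_le r lam) _ _
      fun I hI hI' mu nu _ _ hov hmu hnu hsgn => det_split_div_eq hk (by omega) hr le_rfl h S T Y
        hY hST J (by omega) hab I hI hI' hov hmu hnu hsgn]
    -- Only the sets I with l - p elements survive, again by counting the rows of the first block.
    apply Finset.sum_subset (Finset.subset_univ _)
    intro I _ hI
    rw [det_split_eq_zero_of_card h, zero_div]
    intro hcard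
    apply hI
    rw [Finset.mem_powersetCard]
    exact ⟨Finset.subset_univ _, by omega⟩
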